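/- A structural pattern is a matrix with entries in $\{0,\star\}$; a real matrix of the same size is a numerical realization of it if it is zero wherever the pattern is $0$ (the entries at $\star$ are free real parameters). A pair of patterns $(\bar A,\bar B)$, with $\bar A\in\{0,\star\}^{n\times n}$ and $\bar B\in\{0,\star\}^{n\times p}$, is structurally controllable if it has a numerical realization $(A,B)$ for which the system $\dot x(t)=Ax(t)+Bu(t)$ is controllable, i.e. every state can be steered to every other state in finite time. Let $\mathbb I_n\in\{0,\star\}^{n\times n}$ be the pattern with $\star$ on the diagonal and $0$ elsewhere, and for $\mathcal J\subseteq\{1,\dots,n\}$ let $\mathbb I_n(\mathcal J)$ consist of the columns of $\mathbb I_n$ with index in $\mathcal J$. **Theorem (minimum dedicated input selection is polynomial).** The following problem can be solved in polynomial time, more precisely in $\mathcal O(n^3)$ steps: given $n$ and an arbitrary pattern $\bar A\in\{0,\star\}^{n\times n}$, determine $$\mathcal J^*\in\arg\min_{\mathcal J\subseteq\{1,\dots,n\}}|\mathcal J|\quad\text{subject to}\quad (\bar A,\mathbb I_n(\mathcal J))\ \text{is structurally controllable},$$ together with the minimum $|\mathcal J^*|$. Here steps are counted on a random access machine with words of $\mathcal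 O(\log n)$ bits: there is one program, independent of $n$ and $\bar A$, that receives $n$ and the $n^2$ entries of $\bar A$ in memory, halts within $T(n)=\mathcal O(n^3)$ steps with the indicator vector of such a set $\mathcal J^*$ and the number $|\mathcal J^*|$ as its output, and only produces natural numbers bounded by a fixed polynomial in $n$. One step is one assignment of a constant, addition, truncated subtraction, multiplication, indirect load or store, or a comparison that controls a branch or a loop. -/

import Mathlib

open Filter Asymptotics

/-! ## Structural controllability -/

/-- The pair `(A, B)`, that is the system `x' = A x + B u` with `n` states and inputs indexed by
`ι`, is controllable: every state can be steered to every state in finite time by a continuous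
input. -/
def Controllable {n : ℕ} {ι : Type} [Fintype ι]
    (A : Matrix (Fin n) (Fin n) ℝ) (B : Matrix (Fin n) ι ℝ) : Prop :=
  ∀ x₀ x₁ : Fin n → ℝ, ∃ T : ℝ, 0 < T ∧
    ∃ (u : ℝ → ι → ℝ) (x : ℝ → Fin n → ℝ),
      ContinuousOn u (Set.Icc 0 T) ∧
      (∀ t ∈ Set.Icc 0 T,
        HasDerivWithinAt x (A.mulVec (x t) + B.mulVec (u t)) (Set.Icc 0 T) t) ∧
      x 0 = x₀ ∧ x T = x₁

/-- A structural pattern, i.e. a matrix with entries in `{0, ⋆}`: `false` is a fixed zero and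
`true` is a free parameter `⋆`. -/
abbrev StructPattern (m k : Type) : Type := Matrix m k Bool

/-- The real matrix `M` is a numerical realization of the pattern `S`: it has zeros in the
locations specified by `S`, and arbitrary real numbers elsewhere. -/
def IsRealization {m k : Type} (M : Matrix m k ℝ) (S : StructPattern m k) : Prop :=
  ∀ i j, S i j = false → M i j = 0

/-- A pair of patterns is structurally controllable if some numerical realization of it is
controllable. -/
def StructurallyControllable {n : ℕ} {ι : Type} [Fintype ι]
    (SA : StructPattern (Fin n) (Fin n)) (SB : StructPattern (Fin n) ι) : Prop :=
  ∃ (A : Matrix (Fin n) (Fin n) ℝ) (B : Matrix (Fin n) ι ℝ),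
    IsRealization A SA ∧ IsRealization B SB ∧ Controllable A B

/-- The `n × n` pattern with `⋆` on the diagonal and `0` elsewhere. -/
def identityPattern (n : ℕ) : StructPattern (Fin n) (Fin n) :=
  Matrix.of fun i j => decide (i = j)

/-- The columns of the pattern `SB` with index in `J`. -/
def selectColumns {n p : ℕ} (SB : StructPattern (Fin n) (Fin p)) (J : Finset (Fin p)) :
    StructPattern (Fin n) J :=
  SB.submatrix id Subtype.val

/-- `J` solves the minimum input selection problem for `(SA, SB)`: it is a set of columns of `SB`
of least cardinality among those that make the pair structurally controllable. -/
def IsMinimumInputSelection {n p : ℕ} (SA : StructPattern (Fin n) (Fin n))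
    (SB : StructPattern (Fin n) (Fin p)) (J : Finset (Fin p)) : Prop :=
  StructurallyControllable SA (selectColumns SB J) ∧
    ∀ J' : Finset (Fin p), StructurallyControllable SA (selectColumns SB J') → J.card ≤ J'.card

/-! ## Random access machines with a step count -/

namespace RAM

/-- The configuration of the data of a random access machine: registers, which the program
addresses directly, and a memory, which it addresses through the contents of registers. -/
structure State where
  reg : ℕ → ℕ
  mem : ℕ → ℕ

/-- Overwrite register `r` by `v`. -/
def State.setReg (s : State) (r v : ℕ) : State :=
  { s with reg := Function.update s.reg r v }

/-- Overwrite the memory cell of address `a` by `v`. -/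
def State.setMem (s : State) (a v : ℕ) : State :=
  { s with mem := Function.update s.mem a v }

/-- Programs of the random access machine. The numbers `r`, `a`, `b` are indices of registers. -/
inductive Prog : Type where
  /-- do nothing -/
  | skip : Prog
  /-- `r := v` -/
  | const (r v : ℕ) : Prog
  /-- `r := a + b` -/
  | add (r a b : ℕ) : Prog
  /-- `r := a - b` (truncated at `0`) -/
  | sub (r a b : ℕ) : Prog
  /-- `r := a * b` -/
  | mul (r a b : ℕ) : Prog
  /-- `r := mem[a]` -/
  | load (r a : ℕ) : Prog
  /-- `mem[a] := r` -/
  | store (a r : ℕ) : Prog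
  /-- first `p`, then `q` -/
  | seq (p q : Prog) : Prog
  /-- `if a < b then p else q` -/
  | ifLt (a b : ℕ) (p q : Prog) : Prog
  /-- `while a < b do p` -/
  | whileLt (a b : ℕ) (p : Prog) : Prog

/-- `Exec W p s t s'`: started in `s`, the program `p` halts in `s'` after exactly `t` steps, and
no number greater than the word bound `W` is produced on the way. Every elementary instruction and
every test of a condition is one step. (`sub`, `load` and `store` need no bound, since they never
produce a number greater than those already stored.) -/
inductive Exec (W : ℕ) : Prog → State → ℕ → State → Prop where
  | skip (s : State) : Exec W .skip s 1 s
  | const (s : State) (r v : ℕ) (hW : v ≤ W) :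
      Exec W (.const r v) s 1 (s.setReg r v)
  | add (s : State) (r a b : ℕ) (hW : s.reg a + s.reg b ≤ W) :
      Exec W (.add r a b) s 1 (s.setReg r (s.reg a + s.reg b))
  | sub (s : State) (r a b : ℕ) :
      Exec W (.sub r a b) s 1 (s.setReg r (s.reg a - s.reg b))
  | mul (s : State) (r a b : ℕ) (hW : s.reg a * s.reg b ≤ W) :
      Exec W (.mul r a b) s 1 (s.setReg r (s.reg a * s.reg b))
  | load (s : State) (r a : ℕ) :
      Exec W (.load r a) s 1 (s.setReg r (s.mem (s.reg a)))
  | store (s : State) (a r : ℕ) :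
      Exec W (.store a r) s 1 (s.setMem (s.reg a) (s.reg r))
  | seq {p q : Prog} {s s' s'' : State} {t t' : ℕ}
      (hp : Exec W p s t s') (hq : Exec W q s' t' s'') :
      Exec W (.seq p q) s (t + t') s''
  | ifTrue {a b : ℕ} {p q : Prog} {s s' : State} {t : ℕ}
      (hc : s.reg a < s.reg b) (hp : Exec W p s t s') :
      Exec W (.ifLt a b p q) s (1 + t) s'
  | ifFalse {a b : ℕ} {p q : Prog} {s s' : State} {t : ℕ}
      (hc : ¬ s.reg a < s.reg b) (hq : Exec W q s t s') :
      Exec W (.ifLt a b p q) s (1 + t) s'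
  | whileTrue {a b : ℕ} {p : Prog} {s s' s'' : State} {t t' : ℕ}
      (hc : s.reg a < s.reg b) (hp : Exec W p s t s')
      (hw : Exec W (.whileLt a b p) s' t' s'') :
      Exec W (.whileLt a b p) s (1 + t + t') s''
  | whileFalse {a b : ℕ} {p : Prog} {s : State}
      (hc : ¬ s.reg a < s.reg b) :
      Exec W (.whileLt a b p) s 1 s

open Classical in
/-- The initial state for the input `SA`: register `0` holds `n`, the memory holds the entries of
`SA` row by row (`1` for `⋆` and `0` for a zero, entry `(i, j)` at address `i * n + j`), and
everything else is `0`. -/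
noncomputable def inputState {n : ℕ} (SA : StructPattern (Fin n) (Fin n)) : State where
  reg := fun r => if r = 0 then n else 0
  mem := fun a => if ∃ i j : Fin n, a = i.val * n + j.val ∧ SA i j = true then 1 else 0

/-- The state `s` holds the output `J`: memory cell `j`, for `j < n`, holds `1` if `j ∈ J` and `0`
otherwise, and register `0` holds the number of elements of `J`. -/
def State.Outputs {n : ℕ} (s : State) (J : Finset (Fin n)) : Prop :=
  (∀ j : Fin n, s.mem j.val = if j ∈ J then 1 else 0) ∧ s.reg 0 = J.card

end RAM

/-!
Controllability with dedicated inputs at `J` is reduced to combinatorics, the combinatorial problem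
to one maximum bipartite matching, and the matching is computed by a program whose cost is read off
from its text.

*Controllability.* By `structurallyControllable_iff`, dedicated inputs at `J` make the pattern
structurally controllable if and only if the rows outside `J` have distinct columns with free
entries, and every nonempty set of states closed under predecessors meets `J`. Necessity: without
the second property some states stay at rest (Gronwall's inequality); and the rows of `A` outside
`J` are linearly independent, so that Hall's theorem provides the columns. Sufficiency: a system of
distinct columns extends to a permutation. Its cycles that meet `J` have a realization none of whose
left eigenvectors vanishes on `J`. The other cycles are attached one at a time, by an arc from a
state already present, with a weight that avoids the finitely many bad ones
(`RealizableOn.attach_cycle`). The absence of left eigenvectors vanishing on `J` gives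
controllability through the variation of constants formula
(`NoEigenvectorVanishingOn.controllable`).

*Optimization.* A source component is a strongly connected component without arcs from outside. To
the bipartite graph of rows and columns one left vertex is added for each source component, adjacent
to its elements. For any maximum matching, the rows not matched to columns, together with one state
of each source component whose vertex is unmatched, are a minimum selection: a feasible selection
`J` yields a matching of size `n - |J| + β`, where `β` is the number of source components, and the
selection made from a matching of size `μ` has at most `n + β - μ` elements
(`isMinimumInputSelection_selectedStates`).

*Algorithm.* Warshall's algorithm finds the source components, and augmenting paths, one search for
each of the `2 n` left vertices, find a maximum matching. Maximality is witnessed by a set `Y` of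
left vertices with `|N(Y)| + |L \ Y|` at most the size of the matching; a failed search enlarges the
witness (`IsCertificate.extend_of_search_failed`), so no theory of augmenting paths is needed.

*Machine.* The program is written in a language of bounded loops, with a total evaluation function
and a static cost that bounds both time and growth of the numbers. Its compilation to the random
access machine is verified once (`Cmd.exec_compile`); correctness of the program
(`Cmd.eval_main`) is then a statement about the evaluation function alone, proved with loop
invariants.
-/

/-! ### Necessary conditions for controllability -/

/-- A set of states on which neither the other states nor the inputs act stays at rest, so a
controllable system has no such nonempty set. -/
theorem Controllable.exists_input_of_closed {n : ℕ} {ι : Type} [Fintype ι]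
    {A : Matrix (Fin n) (Fin n) ℝ} {B : Matrix (Fin n) ι ℝ} (h : Controllable A B)
    {S : Set (Fin n)} (hS : S.Nonempty) (hcl : ∀ i ∈ S, ∀ j, A i j ≠ 0 → j ∈ S) :
    ∃ i ∈ S, ∃ k, B i k ≠ 0 := by
  classical
  by_contra! hB
  obtain ⟨T, hT, u, x, -, hx, hx0, hx1⟩ := h 0 (fun _ => 1)
  -- the coordinates in `S`, extended by zero, solve a homogeneous linear equation
  set y : ℝ → Fin n → ℝ := fun t i => if i ∈ S then x t i else 0 with hy
  set P : (Fin n → ℝ) →L[ℝ] (Fin n → ℝ) :=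
    ContinuousLinearMap.pi fun i =>
      if i ∈ S then ContinuousLinearMap.proj (R := ℝ) (φ := fun _ : Fin n => ℝ) i else 0 with hP
  have hPy : ∀ t, P (x t) = y t := by
    intro t; ext i; by_cases hi : i ∈ S <;> simp [hP, hy, hi]
  set L : (Fin n → ℝ) →L[ℝ] (Fin n → ℝ) := P.comp (LinearMap.toContinuousLinearMap A.mulVecLin)
  have hder : ∀ t ∈ Set.Icc 0 T, HasDerivWithinAt y (L (y t)) (Set.Icc 0 T) t := by
    intro t ht
    have h1 := P.hasFDerivAt.comp_hasDerivWithinAt t (hx t ht)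
    have h2 : P (A.mulVec (x t) + B.mulVec (u t)) = L (y t) := by
      ext i
      by_cases hi : i ∈ S
      · have hb : (B.mulVec (u t)) i = 0 := by
          simp [Matrix.mulVec, dotProduct, hB i hi]
        have ha : (A.mulVec (x t)) i = (A.mulVec (y t)) i := by
          simp only [Matrix.mulVec, dotProduct]
          refine Finset.sum_congr rfl fun j _ => ?_
          by_cases hij : A i j = 0
          · simp [hij]
          · simp [hy, hcl i hi j hij]
        simp [L, hP, hi, hb, ha]
      · simp [L, hP, hi]
    rw [h2] at h1
    exact h1.congr (fun s _ => (hPy s).symm) (hPy t).symm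
  have hzero := eq_zero_of_abs_deriv_le_mul_abs_self_of_eq_zero_right (f := y)
    (f' := fun t => L (y t)) (K := ‖L‖) (a := 0) (b := T)
    (fun t ht => (hder t ht).continuousWithinAt)
    (fun t ht => (hder t ⟨ht.1, ht.2.le⟩).mono_of_mem_nhdsWithin (Icc_mem_nhdsGE_of_mem ht))
    (by ext i; simp [hy, hx0]) (fun t _ => L.le_opNorm _) T ⟨hT.le, le_rfl⟩
  obtain ⟨i, hi⟩ := hS
  have := congrFun hzero i
  simp [hy, hi, hx1] at this

/-- A linear functional that annihilates `A` and `B` is constant along all trajectories. -/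
theorem Controllable.eq_zero_of_vecMul {n : ℕ} {ι : Type} [Fintype ι]
    {A : Matrix (Fin n) (Fin n) ℝ} {B : Matrix (Fin n) ι ℝ} (h : Controllable A B)
    {w : Fin n → ℝ} (hA : Matrix.vecMul w A = 0) (hB : Matrix.vecMul w B = 0) : w = 0 := by
  obtain ⟨T, hT, u, x, -, hx, hx0, hx1⟩ := h 0 w
  set P : (Fin n → ℝ) →L[ℝ] ℝ := LinearMap.toContinuousLinearMap (dotProductBilin ℝ ℝ w) with hP
  have hPd : ∀ v, P v = w ⬝ᵥ v := fun v => rfl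
  have hder : ∀ t ∈ Set.Icc 0 T, HasDerivWithinAt (fun t => P (x t)) 0 (Set.Icc 0 T) t := by
    intro t ht
    have h1 := P.hasFDerivAt.comp_hasDerivWithinAt t (hx t ht)
    have h2 : P (A.mulVec (x t) + B.mulVec (u t)) = 0 := by
      rw [hPd, dotProduct_add, Matrix.dotProduct_mulVec, Matrix.dotProduct_mulVec, hA, hB]
      simp
    rwa [h2] at h1
  have hc := constant_of_has_deriv_right_zero (f := fun t => P (x t)) (a := 0) (b := T)
    (fun t ht => (hder t ht).continuousWithinAt)
    (fun t ht => (hder t ⟨ht.1, ht.2.le⟩).mono_of_mem_nhdsWithin (Icc_mem_nhdsGE_of_mem ht))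
    T ⟨hT.le, le_rfl⟩
  simp only [hx0, hx1, hPd] at hc
  simpa using hc

/-- Rows on which the input matrix vanishes admit distinct columns carrying nonzero entries of the
state matrix: these rows are linearly independent, so Hall's condition holds. -/
theorem Controllable.exists_injective_column {n : ℕ} {ι : Type} [Fintype ι]
    {A : Matrix (Fin n) (Fin n) ℝ} {B : Matrix (Fin n) ι ℝ} (h : Controllable A B)
    {D : Set (Fin n)} (hD : ∀ i ∈ D, ∀ k, B i k = 0) :
    ∃ f : D → Fin n, Function.Injective f ∧ ∀ i : D, A i (f i) ≠ 0 := by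
  classical
  have hall := (Finset.all_card_le_biUnion_card_iff_exists_injective
    (fun i : D => Finset.univ.filter fun j => A i j ≠ 0)).1 ?_
  · obtain ⟨f, hf, hf'⟩ := hall
    exact ⟨f, hf, fun i => by simpa using hf' i⟩
  intro s
  set N := s.biUnion (fun i : D => Finset.univ.filter fun j => A i j ≠ 0) with hN
  -- the rows in `s`, restricted to the columns in `N`
  have hli : LinearIndependent ℝ (fun i : s => fun j : N => A (i : D) j) := by
    rw [Fintype.linearIndependent_iff]
    intro g hg
    set w : Fin n → ℝ := fun i => if hi : ∃ hD : i ∈ D, (⟨i, hD⟩ : D) ∈ s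
      then g ⟨⟨i, hi.1⟩, hi.2⟩ else 0 with hw
    have hws : ∀ i : s, w (i : D) = g i := by
      rintro ⟨⟨i, hi⟩, hi'⟩
      simp [hw, hi, hi']
    have hsum : ∀ c : Fin n → ℝ, ∑ i, w i * c i = ∑ i : s, g i * c (i : D) := by
      intro c
      symm
      refine Finset.sum_of_injOn (fun i : s => ((i : D) : Fin n))
        (fun a _ b _ hab => Subtype.ext (Subtype.ext hab)) (by simp) ?_ ?_
      · intro i _ hi
        have : w i = 0 := by
          simp only [hw]
          rw [dif_neg]
          rintro ⟨h1, h2⟩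
          exact hi ⟨⟨⟨i, h1⟩, h2⟩, by simp⟩
        simp [this]
      · intro i _
        simp [hws]
    have hw0 : w = 0 := by
      refine h.eq_zero_of_vecMul ?_ ?_
      · ext j
        simp only [Matrix.vecMul, dotProduct, Pi.zero_apply]
        rw [hsum fun i => A i j]
        by_cases hj : j ∈ N
        · simpa using congrFun hg ⟨j, hj⟩
        · refine Finset.sum_eq_zero fun i _ => ?_
          have : A (i : D) j = 0 := by
            by_contra hne
            exact hj (by rw [hN, Finset.mem_biUnion]; exact ⟨i, i.2, by simpa using hne⟩)
          simp [this]
      · ext k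
        simp only [Matrix.vecMul, dotProduct, Pi.zero_apply]
        rw [hsum fun i => B i k]
        exact Finset.sum_eq_zero fun i _ => by simp [hD _ (i : D).2]
    intro i
    rw [← hws, hw0]; rfl
  have := hli.fintype_card_le_finrank
  simpa using this

/-! ### An eigenvector test for controllability -/

/-- No left eigenvector of `A` vanishes on `K`: the eigenvector test for the controllability of
`(A, B)`, where the columns of `B` are the unit vectors with index in `K`. -/
def NoEigenvectorVanishingOn {n : ℕ} (K : Set (Fin n)) (A : Matrix (Fin n) (Fin n) ℂ) : Prop :=
  ∀ (μ : ℂ) (w : Fin n → ℂ), (∀ j ∈ K, w j = 0) → Matrix.vecMul w A = μ • w → w = 0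

/-- A subspace of vectors vanishing on `K` that `A` maps into itself contains an eigenvector. -/
theorem NoEigenvectorVanishingOn.eq_bot {n : ℕ} {K : Set (Fin n)} {A : Matrix (Fin n) (Fin n) ℂ}
    (h : NoEigenvectorVanishingOn K A) (U : Submodule ℂ (Fin n → ℂ))
    (hK : ∀ w ∈ U, ∀ j ∈ K, w j = 0) (hA : ∀ w ∈ U, Matrix.vecMul w A ∈ U) : U = ⊥ := by
  by_contra hU
  have : Nontrivial U := Submodule.nontrivial_iff_ne_bot.2 hU
  obtain ⟨μ, hμ⟩ := Module.End.exists_eigenvalue ((Matrix.vecMulLinear A).restrict hA)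
  obtain ⟨w, hw, hw0⟩ := hμ.exists_hasEigenvector
  rw [Module.End.mem_eigenspace_iff] at hw
  have hw' := congrArg Subtype.val hw
  exact hw0 (Subtype.ext (h μ w (hK w w.2) hw'))

/-- Otherwise the vectors `z` with `z A ^ k` vanishing on `K` for all `k` are a nonzero invariant
subspace, which contains an eigenvector. -/
theorem exists_pow_apply_ne_zero {n : ℕ} {K : Set (Fin n)}
    {A : Matrix (Fin n) (Fin n) ℝ} (h : NoEigenvectorVanishingOn K (A.map (algebraMap ℝ ℂ)))
    {w : Fin n → ℝ} (hw : w ≠ 0) : ∃ k : ℕ, ∃ j ∈ K, Matrix.vecMul w (A ^ k) j ≠ 0 := by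
  by_contra! h0
  let U : Submodule ℂ (Fin n → ℂ) :=
    { carrier := {z | ∀ k : ℕ, ∀ j ∈ K, Matrix.vecMul z ((A.map (algebraMap ℝ ℂ)) ^ k) j = 0}
      add_mem' := fun ha hb k j hj => by
        rw [Matrix.add_vecMul, Pi.add_apply, ha k j hj, hb k j hj, add_zero]
      zero_mem' := fun k j hj => by simp
      smul_mem' := fun c z hz k j hj => by
        rw [Matrix.smul_vecMul, Pi.smul_apply, hz k j hj, smul_zero] }
  have hbot : U = ⊥ := by
    refine h.eq_bot U (fun z hz j hj => by simpa using hz 0 j hj) (fun z hz k j hj => ?_)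
    rw [Matrix.vecMul_vecMul, ← pow_succ']
    exact hz (k + 1) j hj
  have hmem : (fun i => (w i : ℂ)) ∈ U := by
    intro k j hj
    have : (A.map (algebraMap ℝ ℂ)) ^ k = (A ^ k).map (algebraMap ℝ ℂ) :=
      ((algebraMap ℝ ℂ).mapMatrix.map_pow A k).symm
    rw [this]
    have := congrArg (algebraMap ℝ ℂ) (h0 k j hj)
    simpa [Matrix.vecMul, dotProduct] using this
  rw [hbot, Submodule.mem_bot] at hmem
  exact hw (funext fun i => by simpa using congrFun hmem i)

section Steering

variable {n : ℕ}

/-- The flow `exp (t A)` of `x' = A x`. -/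
noncomputable def flow (A : Matrix (Fin n) (Fin n) ℝ) (t : ℝ) : (Fin n → ℝ) →L[ℝ] (Fin n → ℝ) :=
  NormedSpace.exp (t • LinearMap.toContinuousLinearMap A.mulVecLin)

theorem hasDerivAt_flow (A : Matrix (Fin n) (Fin n) ℝ) (t : ℝ) :
    HasDerivAt (flow A) (LinearMap.toContinuousLinearMap A.mulVecLin * flow A t) t :=
  hasDerivAt_exp_smul_const' (𝔸 := (Fin n → ℝ) →L[ℝ] (Fin n → ℝ)) _ t

theorem hasDerivAt_flow' (A : Matrix (Fin n) (Fin n) ℝ) (t : ℝ) :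
    HasDerivAt (flow A) (flow A t * LinearMap.toContinuousLinearMap A.mulVecLin) t :=
  hasDerivAt_exp_smul_const (𝔸 := (Fin n → ℝ) →L[ℝ] (Fin n → ℝ)) _ t

theorem continuous_flow (A : Matrix (Fin n) (Fin n) ℝ) : Continuous (flow A) :=
  continuous_iff_continuousAt.2 fun t => (hasDerivAt_flow A t).continuousAt

theorem flow_zero (A : Matrix (Fin n) (Fin n) ℝ) : flow A 0 = 1 := by
  simp [flow]

theorem flow_mul_flow_neg (A : Matrix (Fin n) (Fin n) ℝ) (t : ℝ) :
    flow A t * flow A (-t) = 1 := by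
  let _ : NormedAlgebra ℚ ((Fin n → ℝ) →L[ℝ] (Fin n → ℝ)) := NormedAlgebra.restrictScalars ℚ ℝ _
  rw [flow, flow, ← NormedSpace.exp_add_of_commute]
  · rw [← add_smul, add_neg_cancel, zero_smul, NormedSpace.exp_zero]
  · exact ((Commute.refl _).smul_left _).smul_right _

theorem flow_flow_neg (A : Matrix (Fin n) (Fin n) ℝ) (t : ℝ) (v : Fin n → ℝ) :
    flow A t (flow A (-t) v) = v := by
  have := congrArg (fun f => f v) (flow_mul_flow_neg A t)
  simpa using this

theorem flow_neg_flow (A : Matrix (Fin n) (Fin n) ℝ) (t : ℝ) (v : Fin n → ℝ) :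
    flow A (-t) (flow A t v) = v := by
  simpa using flow_flow_neg A (-t) v

/-- A functional that vanishes on `exp (-s A) b` for all `s` in an interval vanishes on
`exp (-s A) A ^ k b` as well: differentiate `k` times. -/
theorem flow_pow_eq_zero {A : Matrix (Fin n) (Fin n) ℝ} {b : Fin n → ℝ}
    {f : (Fin n → ℝ) →L[ℝ] ℝ} (h : ∀ s ∈ Set.Ioo (0 : ℝ) 1, f (flow A (-s) b) = 0) (k : ℕ) :
    ∀ s ∈ Set.Ioo (0 : ℝ) 1, f (flow A (-s) ((A ^ k).mulVec b)) = 0 := by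
  induction k with
  | zero => simpa using h
  | succ k ih =>
    intro s hs
    have h1 : HasDerivAt (fun s => flow A (-s))
        (-(flow A (-s) * LinearMap.toContinuousLinearMap A.mulVecLin)) s := by
      have := (hasDerivAt_flow' A (-s)).scomp s (hasDerivAt_neg s)
      rwa [neg_one_smul] at this
    have h2 := f.hasFDerivAt.comp_hasDerivAt s
      (h1.clm_apply (hasDerivAt_const s ((A ^ k).mulVec b)))
    have h3 : (fun s => f (flow A (-s) ((A ^ k).mulVec b))) =ᶠ[nhds s] fun _ => 0 :=
      Filter.eventually_of_mem (isOpen_Ioo.mem_nhds hs) ih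
    have h4 := h2.unique ((hasDerivAt_const s (0 : ℝ)).congr_of_eventuallyEq h3)
    simpa [pow_succ', Matrix.mulVec_mulVec] using h4

/-- Steering. By the variation of constants formula the states reachable from a given one form a
translate of a subspace. A functional `f` vanishing on this subspace vanishes on the state reached
with the input `s ↦ f (exp (-s A) b_j)`, which forces this input to be zero. -/
theorem NoEigenvectorVanishingOn.controllable {A : Matrix (Fin n) (Fin n) ℝ}
    {J : Finset (Fin n)} (h : NoEigenvectorVanishingOn (J : Set (Fin n)) (A.map (algebraMap ℝ ℂ))) :
    Controllable A (Matrix.of fun (i : Fin n) (j : J) => if i = j then (1 : ℝ) else 0) := by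
  set B : Matrix (Fin n) J ℝ := Matrix.of fun (i : Fin n) (j : J) => if i = j then (1 : ℝ) else 0
  have hBcont : ∀ {u : ℝ → J → ℝ}, Continuous u → Continuous fun s => B.mulVec (u s) := fun hu =>
    (LinearMap.toContinuousLinearMap B.mulVecLin).continuous.comp hu
  have hcont : ∀ {u : ℝ → J → ℝ}, Continuous u →
      Continuous fun s => flow A (-s) (B.mulVec (u s)) := fun hu =>
    ((continuous_flow A).comp continuous_neg).clm_apply (hBcont hu)
  let R : Submodule ℝ (Fin n → ℝ) :=
    { carrier := {y | ∃ u : ℝ → J → ℝ, Continuous u ∧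
        ∫ s in (0 : ℝ)..1, flow A (-s) (B.mulVec (u s)) = y}
      add_mem' := by
        rintro _ _ ⟨u, hu, rfl⟩ ⟨v, hv, rfl⟩
        refine ⟨u + v, hu.add hv, ?_⟩
        rw [← intervalIntegral.integral_add ((hcont hu).intervalIntegrable _ _)
          ((hcont hv).intervalIntegrable _ _)]
        simp [Matrix.mulVec_add]
      zero_mem' := ⟨0, continuous_const, by simp⟩
      smul_mem' := by
        rintro c _ ⟨u, hu, rfl⟩
        refine ⟨c • u, hu.const_smul c, ?_⟩
        rw [← intervalIntegral.integral_smul]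
        simp [Matrix.mulVec_smul] }
  have hR : R = ⊤ := by
    by_contra hne
    obtain ⟨f', hf0, hf⟩ := R.exists_le_ker_of_lt_top (lt_top_iff_ne_top.2 hne)
    set f : (Fin n → ℝ) →L[ℝ] ℝ := LinearMap.toContinuousLinearMap f' with hfdef
    set u : ℝ → J → ℝ := fun s j => f (flow A (-s) (Pi.single (j : Fin n) 1)) with hu
    have huc : Continuous u := continuous_pi fun j =>
      f.continuous.comp (((continuous_flow A).comp continuous_neg).clm_apply continuous_const)
    have hBu : ∀ s, B.mulVec (u s) = ∑ j : J, u s j • Pi.single (j : Fin n) (1 : ℝ) := by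
      intro s; ext i
      simp [B, Matrix.mulVec, dotProduct, Pi.single_apply, Finset.sum_apply]
    have hfu : ∀ s, f (flow A (-s) (B.mulVec (u s))) = ∑ j : J, u s j ^ 2 := by
      intro s
      rw [hBu]
      simp only [map_sum, map_smul, smul_eq_mul, sq]
      rfl
    have hint : ∫ s in (0 : ℝ)..1, ∑ j : J, u s j ^ 2 = 0 := by
      have h1 := f.intervalIntegral_comp_comm ((hcont huc).intervalIntegrable
        (μ := MeasureTheory.volume) 0 1)
      simp only [hfu] at h1
      rw [h1]
      exact hf ⟨u, huc, rfl⟩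
    have hzero : ∀ s ∈ Set.Icc (0 : ℝ) 1, ∀ j, u s j = 0 := by
      intro s hs j
      by_contra hj
      have hpos := intervalIntegral.integral_pos (f := fun s => ∑ j : J, u s j ^ 2)
        (zero_lt_one' ℝ) (by fun_prop) (fun s _ => Finset.sum_nonneg fun _ _ => sq_nonneg _)
        ⟨s, hs, Finset.sum_pos' (fun _ _ => sq_nonneg _) ⟨j, Finset.mem_univ _, by positivity⟩⟩
      exact hpos.ne' hint
    -- the functional at time `1 / 2`, as a row vector
    set w : Fin n → ℝ := fun i => f (flow A (-(1 / 2)) (Pi.single i 1)) with hw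
    have hwdot : ∀ v : Fin n → ℝ, w ⬝ᵥ v = f (flow A (-(1 / 2)) v) := by
      intro v
      conv_rhs => rw [pi_eq_sum_univ' v]
      simp only [map_sum, map_smul, smul_eq_mul, dotProduct, hw]
      refine Finset.sum_congr rfl fun i _ => ?_
      rw [mul_comm]
    have hw0 : w ≠ 0 := by
      intro h0
      refine hf0 (LinearMap.ext fun v => ?_)
      have := hwdot (flow A (1 / 2) v)
      rw [flow_neg_flow, h0] at this
      simpa [hfdef] using this.symm
    obtain ⟨k, j, hj, hkj⟩ := exists_pow_apply_ne_zero h hw0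
    refine hkj ?_
    have h1 := flow_pow_eq_zero (A := A) (b := Pi.single j 1) (f := f)
      (fun s hs => hzero s ⟨hs.1.le, hs.2.le⟩ ⟨j, hj⟩) k (1 / 2) (by norm_num)
    rw [← hwdot, Matrix.dotProduct_mulVec] at h1
    simpa using h1
  intro x₀ x₁
  have hmem : flow A (-1) x₁ - x₀ ∈ R := hR ▸ Submodule.mem_top
  obtain ⟨u, hu, hint⟩ := hmem
  refine ⟨1, one_pos, u,
    fun t => flow A t (x₀ + ∫ s in (0 : ℝ)..t, flow A (-s) (B.mulVec (u s))),
    hu.continuousOn, fun t _ => ?_, by simp [flow_zero], ?_⟩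
  · have h1 := ((hcont hu).integral_hasStrictDerivAt 0 t).hasDerivAt.const_add x₀
    have h2 := (hasDerivAt_flow A t).clm_apply h1
    rw [flow_flow_neg] at h2
    exact h2.hasDerivWithinAt
  · simp only [hint]
    rw [add_sub_cancel, flow_flow_neg]

end Steering

/-! ### Realizations built from cycles -/

/-- If no left eigenvector vanishes on `K`, the resolvent equation `w M = μ w + e`, `e ≠ 0`, has a
solution vanishing on `K` for finitely many `μ` only: a linear relation between such solutions
either puts `e` into their span, which is then invariant, or survives multiplication by `M`. -/
theorem NoEigenvectorVanishingOn.finite_resolvent {n : ℕ} {K : Set (Fin n)}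
    {M : Matrix (Fin n) (Fin n) ℂ} (h : NoEigenvectorVanishingOn K M) {e : Fin n → ℂ}
    (he : e ≠ 0) :
    {μ : ℂ | ∃ w : Fin n → ℂ, (∀ j ∈ K, w j = 0) ∧ Matrix.vecMul w M = μ • w + e}.Finite := by
  classical
  by_contra hinf
  set Λ := {μ : ℂ | ∃ w : Fin n → ℂ, (∀ j ∈ K, w j = 0) ∧ Matrix.vecMul w M = μ • w + e}
  choose w hwK hwM using fun μ : Λ => μ.2
  have : Infinite Λ := Set.infinite_coe_iff.2 hinf
  set U := Submodule.span ℂ (Set.range w) with hU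
  have hwU : ∀ μ, w μ ∈ U := fun μ => Submodule.subset_span ⟨μ, rfl⟩
  have heU : e ∈ U := by
    by_contra heU
    have hdep : ¬ LinearIndependent ℂ w := fun hli => hli.finite.false
    obtain ⟨s, g, hg, i, his, hgi⟩ := not_linearIndependent_iff.1 hdep
    have hpow : ∀ k : ℕ, ∑ μ ∈ s, (g μ * (μ : ℂ) ^ k) • w μ = 0 ∧
        ∑ μ ∈ s, g μ * (μ : ℂ) ^ k = 0 := by
      have hstep : ∀ k : ℕ, ∑ μ ∈ s, (g μ * (μ : ℂ) ^ k) • w μ = 0 →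
          ∑ μ ∈ s, g μ * (μ : ℂ) ^ k = 0 ∧ ∑ μ ∈ s, (g μ * (μ : ℂ) ^ (k + 1)) • w μ = 0 := by
        intro k hk
        have h1 := congrArg (Matrix.vecMulLinear M) hk
        simp only [map_sum, map_smul, Matrix.vecMulLinear_apply, hwM, map_zero, smul_add,
          Finset.sum_add_distrib, ← Finset.sum_smul, smul_smul, mul_assoc, ← pow_succ] at h1
        have h2 : ∑ μ ∈ s, g μ * (μ : ℂ) ^ k = 0 := by
          by_contra hne
          refine heU ?_
          have h3 : (∑ μ ∈ s, g μ * (μ : ℂ) ^ k) • e ∈ U := by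
            rw [eq_neg_of_add_eq_zero_right h1]
            exact U.neg_mem (U.sum_mem fun μ _ => U.smul_mem _ (hwU μ))
          exact (U.smul_mem_iff hne).1 h3
        rw [h2, zero_smul, add_zero] at h1
        exact ⟨h2, h1⟩
      intro k
      have hk : ∑ μ ∈ s, (g μ * (μ : ℂ) ^ k) • w μ = 0 := by
        induction k with
        | zero => simpa using hg
        | succ k ih => exact (hstep k ih).2
      exact ⟨hk, (hstep k hk).1⟩
    have hpoly : ∀ p : Polynomial ℂ, ∑ μ ∈ s, g μ * p.eval (μ : ℂ) = 0 := by
      intro p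
      simp only [Polynomial.eval_eq_sum_range, Finset.mul_sum]
      rw [Finset.sum_comm]
      refine Finset.sum_eq_zero fun k _ => ?_
      have := congrArg (p.coeff k * ·) (hpow k).2
      simp only [Finset.mul_sum, mul_zero] at this
      rw [← this]
      exact Finset.sum_congr rfl fun μ _ => by ring
    -- a polynomial that vanishes at all points of the relation but one
    have h1 := hpoly (∏ ν ∈ s.erase i, (Polynomial.X - Polynomial.C (ν : ℂ)))
    simp only [Polynomial.eval_prod, Polynomial.eval_sub, Polynomial.eval_X,
      Polynomial.eval_C] at h1
    rw [Finset.sum_eq_single_of_mem i his] at h1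
    · refine (mul_ne_zero hgi (Finset.prod_ne_zero_iff.2 fun ν hν => ?_)) h1
      exact sub_ne_zero.2 fun heq => (Finset.ne_of_mem_erase hν) (Subtype.ext heq).symm
    · intro μ hμ hμi
      rw [Finset.prod_eq_zero (Finset.mem_erase.2 ⟨hμi, hμ⟩) (sub_self _), mul_zero]
  have hbot := h.eq_bot U
    (fun v hv j hj => by
      induction hv using Submodule.span_induction with
      | mem x hx => obtain ⟨μ, rfl⟩ := hx; exact hwK μ j hj
      | zero => rfl
      | add x y _ _ hx hy => simp [hx, hy]
      | smul c x _ hx => simp [hx])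
    (fun v hv => by
      induction hv using Submodule.span_induction with
      | mem x hx =>
        obtain ⟨μ, rfl⟩ := hx
        rw [hwM]
        exact U.add_mem (U.smul_mem _ (hwU μ)) heU
      | zero => simp
      | add x y _ _ hx hy => rw [Matrix.add_vecMul]; exact U.add_mem hx hy
      | smul c x _ hx => rw [Matrix.smul_vecMul]; exact U.smul_mem _ hx)
  rw [hbot, Submodule.mem_bot] at heU
  exact he heU

section Cycles

variable {n : ℕ} (SA : StructPattern (Fin n) (Fin n)) (J : Finset (Fin n))

/-- The part `S` of the states has a realization of its own, without entries outside `S`, that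
passes the eigenvector test for vectors supported on `S` and vanishing on `J`. -/
def RealizableOn (S : Finset (Fin n)) : Prop :=
  ∃ A : Matrix (Fin n) (Fin n) ℝ, IsRealization A SA ∧ (∀ i j, A i j ≠ 0 → i ∈ S ∧ j ∈ S) ∧
    NoEigenvectorVanishingOn {j | j ∈ S → j ∈ J} (A.map (algebraMap ℝ ℂ))

variable {SA J} {τ : Equiv.Perm (Fin n)}

/-- The cycles of `τ` that meet `J`: along such a cycle a left eigenvector propagates from its
value zero in `J`. -/
theorem realizableOn_cycles (hτ : ∀ i ∉ J, SA i (τ i) = true) :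
    ∃ S : Finset (Fin n), J ⊆ S ∧ (∀ i, i ∈ S ↔ τ i ∈ S) ∧ RealizableOn SA J S := by
  classical
  set S : Finset (Fin n) := Finset.univ.filter fun i => ∃ j ∈ J, τ.SameCycle i j with hS
  have hSmem : ∀ i, i ∈ S ↔ ∃ j ∈ J, τ.SameCycle i j := by simp [hS]
  have hJS : J ⊆ S := fun j hj => (hSmem j).2 ⟨j, hj, Equiv.Perm.SameCycle.refl _ _⟩
  have hτS : ∀ i, i ∈ S ↔ τ i ∈ S := by
    intro i; simp [hSmem, Equiv.Perm.sameCycle_apply_left]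
  refine ⟨S, hJS, hτS, Matrix.of fun i j => if i ∈ S ∧ i ∉ J ∧ j = τ i then 1 else 0, ?_, ?_, ?_⟩
  · intro i j hij
    simp only [Matrix.of_apply]
    rw [if_neg]
    rintro ⟨-, h1, rfl⟩
    simp [hτ i h1] at hij
  · intro i j hij
    simp only [Matrix.of_apply, ne_eq, ite_eq_right_iff, Classical.not_imp] at hij
    obtain ⟨⟨h1, -, rfl⟩, -⟩ := hij
    exact ⟨h1, (hτS i).1 h1⟩
  · intro μ w hw hμ
    -- the equation in the column of the arc into `i`
    have hstep : ∀ i ∈ S, i ∉ J → w i = μ * w (τ i) := by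
      intro i hi hiJ
      have := congrFun hμ (τ i)
      simp only [Matrix.vecMul, dotProduct, Matrix.map_apply, Matrix.of_apply, Pi.smul_apply,
        smul_eq_mul] at this
      rw [← this, Finset.sum_eq_single i]
      · simp [hi, hiJ]
      · intro k _ hk
        rw [if_neg]
        · simp
        · rintro ⟨-, -, h⟩
          exact hk (τ.injective h.symm)
      · simp
    have hpow : ∀ k : ℕ, ∀ i, (τ ^ k) i ∈ J → w i = 0 := by
      intro k
      induction k with
      | zero => intro i hi; exact hw i fun _ => by simpa using hi
      | succ k ih =>
        intro i hi
        by_cases hiJ : i ∈ J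
        · exact hw i fun _ => hiJ
        by_cases hiS : i ∈ S
        · rw [hstep i hiS hiJ, ih (τ i) (by rwa [pow_succ] at hi), mul_zero]
        · exact hw i fun h => absurd h hiS
    ext i
    by_cases hiS : i ∈ S
    · obtain ⟨j, hj, hij⟩ := (hSmem i).1 hiS
      obtain ⟨k, -, hk⟩ := hij.exists_pow_eq'
      exact hpow k i (hk ▸ hj)
    · exact hw i fun h => absurd h hiS

/-- Attach to `S` one more cycle of `τ`, through `h`, by an arc from `u ∈ S` to `h`. With weight
`c` on its arcs the cycle resonates at `|μ| = c` only, and there it forces the states of `S` along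
`u`; all but finitely many `c` avoid the exceptional resolvent equations. -/
theorem RealizableOn.attach_cycle {S : Finset (Fin n)} (hS : RealizableOn SA J S) (hJS : J ⊆ S)
    (hτS : ∀ i, i ∈ S ↔ τ i ∈ S) (hτ : ∀ i ∉ J, SA i (τ i) = true) {u h : Fin n} (hu : u ∈ S)
    (hh : h ∉ S) (hhu : SA h u = true) :
    ∃ S' : Finset (Fin n), S ⊂ S' ∧ (∀ i, i ∈ S' ↔ τ i ∈ S') ∧ RealizableOn SA J S' := by
  classical
  obtain ⟨A, hA, hAS, hE⟩ := hS
  set C : Finset (Fin n) := Finset.univ.filter fun i => τ.SameCycle h i with hC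
  have hCmem : ∀ i, i ∈ C ↔ τ.SameCycle h i := by simp [hC]
  have hτC : ∀ i, i ∈ C ↔ τ i ∈ C := by
    intro i; simp [hCmem, Equiv.Perm.sameCycle_apply_right]
  have hhC : h ∈ C := (hCmem h).2 (Equiv.Perm.SameCycle.refl _ _)
  have hCS : ∀ i ∈ C, i ∉ S := by
    intro i hi hiS
    obtain ⟨k, -, hk⟩ := ((hCmem i).1 hi).exists_pow_eq'
    have : ∀ k : ℕ, ∀ i, (τ ^ k) i ∈ S → i ∈ S := by
      intro k
      induction k with
      | zero => intro i hi; simpa using hi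
      | succ k ih => intro i hi; exact (hτS i).2 (ih _ (by rwa [pow_succ] at hi))
    exact hh (this k h (hk ▸ hiS))
  have hfin := hE.finite_resolvent (e := -Pi.single u 1)
    (by simp)
  obtain ⟨c, hc0, hc⟩ : ∃ c : ℕ, 0 < c ∧ ∀ μ : ℂ, ‖μ‖ = c → ¬ ∃ w : Fin n → ℂ,
      (∀ j ∈ {j | j ∈ S → j ∈ J}, w j = 0) ∧
        Matrix.vecMul w (A.map (algebraMap ℝ ℂ)) = μ • w + -Pi.single u 1 := by
    by_contra! hcon
    have hcon' : ∀ c : ℕ, ∃ μ : ℂ, ‖μ‖ = (c + 1 : ℕ) ∧ ∃ w : Fin n → ℂ,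
      (∀ j ∈ {j | j ∈ S → j ∈ J}, w j = 0) ∧
        Matrix.vecMul w (A.map (algebraMap ℝ ℂ)) = μ • w + -Pi.single u 1 :=
      fun c => hcon (c + 1) c.succ_pos
    choose μ hμ hμ' using hcon'
    refine Set.infinite_of_injective_forall_mem (f := μ) (fun a b hab => ?_) hμ' hfin
    have : ((a + 1 : ℕ) : ℝ) = (b + 1 : ℕ) := by rw [← hμ, ← hμ, hab]
    exact_mod_cast Nat.succ_injective (by exact_mod_cast this)
  refine ⟨S ∪ C, ?_, ?_, A + Matrix.of (fun i j =>
    (if i ∈ C ∧ j = τ i then (c : ℝ) else 0) + if i = h ∧ j = u then 1 else 0), ?_, ?_, ?_⟩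
  · exact Finset.ssubset_iff_subset_ne.2 ⟨Finset.subset_union_left, fun heq =>
      hh (heq ▸ Finset.mem_union_right _ hhC)⟩
  · intro i
    rw [Finset.mem_union, Finset.mem_union, hτS i, hτC i]
  · intro i j hij
    have h1 : ¬ (i ∈ C ∧ j = τ i) := by
      rintro ⟨hi, rfl⟩
      simp [hτ i fun h => hCS i hi (hJS h)] at hij
    have h2 : ¬ (i = h ∧ j = u) := by
      rintro ⟨rfl, rfl⟩
      simp [hhu] at hij
    simp [hA i j hij, h1, h2]
  · intro i j hij
    by_contra hne
    refine hij ?_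
    have h0 : A i j = 0 := by
      by_contra h0
      exact hne ⟨Finset.mem_union_left _ (hAS i j h0).1, Finset.mem_union_left _ (hAS i j h0).2⟩
    have h1 : ¬ (i ∈ C ∧ j = τ i) := by
      rintro ⟨hi, rfl⟩
      exact hne ⟨Finset.mem_union_right _ hi, Finset.mem_union_right _ ((hτC i).1 hi)⟩
    have h2 : ¬ (i = h ∧ j = u) := by
      rintro ⟨rfl, rfl⟩
      exact hne ⟨Finset.mem_union_right _ hhC, Finset.mem_union_left _ hu⟩
    simp [h0, h1, h2]
  · intro μ w hw hμ
    have hcol : ∀ j, Matrix.vecMul w (A.map (algebraMap ℝ ℂ)) j +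
        (if j ∈ C then c * w (τ.symm j) else 0) + (if j = u then w h else 0) = μ * w j := by
      intro j
      have := congrFun hμ j
      simp only [Matrix.vecMul, dotProduct, Matrix.map_apply, Matrix.of_apply, Pi.smul_apply,
        smul_eq_mul, Matrix.add_apply, map_add, mul_add, Finset.sum_add_distrib] at this
      rw [← this, ← add_assoc]
      congr 1
      · congr 1
        rw [Finset.sum_eq_single (τ.symm j)]
        · have : τ.symm j ∈ C ↔ j ∈ C := by rw [hτC]; simp
          by_cases hj : j ∈ C <;> simp [this, hj, mul_comm]
        · intro k _ hk
          rw [if_neg]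
          · simp
          · rintro ⟨-, rfl⟩
            simp at hk
        · simp
      · rw [Finset.sum_eq_single h]
        · by_cases hj : j = u <;> simp [hj]
        · intro k _ hk
          simp [hk]
        · simp
    have hAC : ∀ j, j ∉ S → Matrix.vecMul w (A.map (algebraMap ℝ ℂ)) j = 0 := by
      intro j hj
      simp only [Matrix.vecMul, dotProduct, Matrix.map_apply]
      refine Finset.sum_eq_zero fun i _ => ?_
      have : A i j = 0 := by
        by_contra h0
        exact hj (hAS i j h0).2
      simp [this]
    -- along the cycle the entries of `w` are multiplied by `μ / c`
    have hstep : ∀ i ∈ C, c * w i = μ * w (τ i) := by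
      intro i hi
      have h1 := hcol (τ i)
      have h2 := (hτC i).1 hi
      have h3 : τ i ≠ u := fun h => hCS _ h2 (h ▸ hu)
      simpa [-Complex.coe_algebraMap, hAC _ (hCS _ h2), h2, h3] using h1
    have hpow : ∀ k : ℕ, ∀ i ∈ C, (c : ℂ) ^ k * w i = μ ^ k * w ((τ ^ k) i) := by
      intro k
      induction k with
      | zero => simp
      | succ k ih =>
        intro i hi
        rw [pow_succ, mul_assoc, hstep i hi, pow_succ τ, Equiv.Perm.mul_apply, pow_succ μ,
          mul_left_comm, ih _ ((hτC i).1 hi)]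
        ring
    have hc0' : (c : ℂ) ≠ 0 := by exact_mod_cast hc0.ne'
    by_cases hwh : w h = 0
    · have hwC : ∀ i ∈ C, w i = 0 := by
        intro i hi
        obtain ⟨k, -, hk⟩ := ((hCmem i).1 hi).symm.exists_pow_eq'
        have := hpow k i hi
        rw [hk, hwh, mul_zero] at this
        exact (mul_eq_zero.1 this).resolve_left (pow_ne_zero _ hc0')
      refine hE μ w (fun j hj => ?_) (funext fun j => ?_)
      · by_cases hjC : j ∈ C
        · exact hwC j hjC
        · refine hw j fun hjS => hj ?_
          exact (Finset.mem_union.1 hjS).resolve_right hjC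
      · have h1 := hcol j
        by_cases hjC : j ∈ C
        · simp [-Complex.coe_algebraMap, hAC j (hCS j hjC), hwC j hjC]
        · simpa [hjC, hwh] using h1
    · exfalso
      -- going round the cycle once shows that `μ` is resonant
      have hμc : ‖μ‖ = c := by
        have h1 := hpow (orderOf τ) h hhC
        rw [pow_orderOf_eq_one, Equiv.Perm.one_apply] at h1
        have h2 := congrArg norm (mul_right_cancel₀ hwh h1)
        rw [norm_pow, norm_pow, Complex.norm_natCast] at h2
        exact ((pow_left_inj₀ (norm_nonneg _) (Nat.cast_nonneg _) (orderOf_pos τ).ne').1 h2.symm)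
      refine hc μ hμc ⟨fun i => if i ∈ S then (w h)⁻¹ * w i else 0, ?_, ?_⟩
      · intro j hj
        by_cases hjS : j ∈ S
        · have := hw j fun _ => hj hjS
          simp [this]
        · simp [hjS]
      · ext j
        have hv : Matrix.vecMul (fun i => if i ∈ S then (w h)⁻¹ * w i else 0)
            (A.map (algebraMap ℝ ℂ)) j =
            (w h)⁻¹ * Matrix.vecMul w (A.map (algebraMap ℝ ℂ)) j := by
          simp only [Matrix.vecMul, dotProduct, Matrix.map_apply, Finset.mul_sum]
          refine Finset.sum_congr rfl fun i _ => ?_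
          by_cases hi : i ∈ S
          · simp [hi, mul_assoc]
          · have : A i j = 0 := by
              by_contra h0
              exact hi (hAS i j h0).1
            simp [this]
        rw [hv]
        by_cases hjS : j ∈ S
        · have h1 := hcol j
          have hjC : j ∉ C := fun h => hCS j h hjS
          rw [if_neg hjC, add_zero] at h1
          rw [eq_sub_of_add_eq h1]
          by_cases hju : j = u
          · subst hju
            simp [hjS]
            field_simp
            ring
          · simp [hjS, hju]
            ring
        · have hju : j ≠ u := fun h => hjS (h ▸ hu)
          simp [-Complex.coe_algebraMap, hjS, hAC j hjS, hju]

/-- Sufficient conditions for structural controllability with dedicated inputs at `J`: a system of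
distinct columns for the rows outside `J`, and every state is reached from `J`. -/
theorem structurallyControllable_of_perm (hτ : ∀ i ∉ J, SA i (τ i) = true)
    (hr : ∀ S : Set (Fin n), S.Nonempty → (∀ i ∈ S, ∀ j, SA i j = true → j ∈ S) →
      ∃ j ∈ J, j ∈ S) :
    StructurallyControllable SA (selectColumns (identityPattern n) J) := by
  classical
  have hall : RealizableOn SA J Finset.univ := by
    obtain ⟨S, hJS, hτS, hS⟩ := realizableOn_cycles hτ
    induction hk : (Finset.univ \ S).card using Nat.strong_induction_on generalizing S with
    | _ k ih =>
      by_cases huniv : S = Finset.univ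
      · exact huniv ▸ hS
      obtain ⟨u, hu, h, hh, hhu⟩ : ∃ u ∈ S, ∃ h, h ∉ S ∧ SA h u = true := by
        by_contra! hcon
        obtain ⟨j, hj, hjS⟩ := hr {i | i ∉ S}
          (by
            by_contra hne
            refine huniv (Finset.eq_univ_iff_forall.2 fun i => ?_)
            by_contra hi
            exact hne ⟨i, hi⟩)
          (fun i hi j hij hj => hcon j hj i hi hij)
        exact hjS (hJS hj)
      obtain ⟨S', hSS', hτS', hS'⟩ := hS.attach_cycle hJS hτS hτ hu hh hhu
      refine ih _ ?_ S' (hJS.trans hSS'.1) hτS' hS' rfl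
      rw [← hk]
      refine Finset.card_lt_card (Finset.ssubset_iff_subset_ne.2 ⟨?_, fun heq => ?_⟩)
      · exact Finset.sdiff_subset_sdiff le_rfl hSS'.1
      · obtain ⟨x, hx, hxS⟩ := Finset.exists_of_ssubset hSS'
        have : x ∈ Finset.univ \ S := by simp [hxS]
        rw [← heq] at this
        simp [hx] at this
  obtain ⟨A, hA, -, hE⟩ := hall
  refine ⟨A, _, hA, ?_, NoEigenvectorVanishingOn.controllable (J := J) (by simpa using hE)⟩
  intro i j hij
  have : i ≠ j := by simpa [selectColumns, identityPattern] using hij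
  simp [this]

end Cycles

/-- Structural controllability with dedicated inputs at `J`, in combinatorial terms. -/
theorem structurallyControllable_iff {n : ℕ} {SA : StructPattern (Fin n) (Fin n)}
    {J : Finset (Fin n)} :
    StructurallyControllable SA (selectColumns (identityPattern n) J) ↔
      (∃ f : Fin n → Fin n, Set.InjOn f {i | i ∉ J} ∧ ∀ i ∉ J, SA i (f i) = true) ∧
      ∀ S : Set (Fin n), S.Nonempty → (∀ i ∈ S, ∀ j, SA i j = true → j ∈ S) →
        ∃ j ∈ J, j ∈ S := by
  classical
  constructor
  · rintro ⟨A, B, hA, hB, hAB⟩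
    have hA' : ∀ i j, A i j ≠ 0 → SA i j = true := fun i j h => by
      by_contra h0
      exact h (hA i j (by simpa using h0))
    have hB' : ∀ (i : Fin n) (j : J), B i j ≠ 0 → i = j := fun i j h => by
      by_contra h0
      exact h (hB i j (by simpa [selectColumns, identityPattern] using h0))
    constructor
    · obtain ⟨f, hf, hf'⟩ := hAB.exists_injective_column (D := {i | i ∉ J}) (by
        intro i hi k
        by_contra h0
        exact hi (hB' i k h0 ▸ k.2))
      refine ⟨fun i => if hi : i ∉ J then f ⟨i, hi⟩ else i, ?_, ?_⟩
      · intro a ha b hb hab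
        simp only [Set.mem_ofPred_eq] at ha hb
        simp only [ha, hb, not_false_eq_true, dite_true] at hab
        exact congrArg Subtype.val (hf hab)
      · intro i hi
        simp only [hi, not_false_eq_true, dite_true]
        exact hA' _ _ (hf' ⟨i, hi⟩)
    · intro S hS hcl
      obtain ⟨i, hi, k, hk⟩ := hAB.exists_input_of_closed hS
        fun i hi j hij => hcl i hi j (hA' i j hij)
      exact ⟨i, hB' i k hk ▸ k.2, hi⟩
  · rintro ⟨⟨f, hf, hf'⟩, hr⟩
    obtain ⟨g, hg⟩ := Finset.exists_equiv_extend_of_card_eq (α := Fin n) (t := Finset.univ)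
      (by simp) (s := Finset.univ.filter fun i => i ∉ J) (f := f) (Finset.subset_univ _)
      (by simpa using hf)
    refine structurallyControllable_of_perm
      (τ := g.trans (Equiv.subtypeUnivEquiv (by simp))) (fun i hi => ?_) hr
    have := hg i (by simpa using hi)
    simpa [this] using hf' i hi

/-! ### A language of bounded loops and its compilation -/

/-- The data of the loop language: variables, matrices of numbers `a t i j` with tag `t`, and the
cells `low` of the memory that hold the input and the output. -/
structure Store where
  v : ℕ → ℕ
  a : ℕ → ℕ → ℕ → ℕ
  low : ℕ → ℕ

/-- Overwrite variable `x` by `k`. -/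
def Store.setV (s : Store) (x k : ℕ) : Store :=
  { s with v := Function.update s.v x k }

/-- Overwrite the entry `(i, j)` of matrix `t` by `k`. -/
def Store.setA (s : Store) (t i j k : ℕ) : Store :=
  { s with a := fun t' i' j' => if t' = t ∧ i' = i ∧ j' = j then k else s.a t' i' j' }

/-- Commands of the loop language. All loops are bounded, and the only arithmetic on variables is
the addition of a constant or of `n`, so that the running time and the growth of the numbers can
be read off from the text. -/
inductive Cmd : Type where
  /-- do nothing -/
  | skip : Cmd
  /-- `x := k` -/
  | const (x k : ℕ) : Cmd
  /-- `x := y + k` -/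
  | addConst (x y k : ℕ) : Cmd
  /-- `x := y + n` -/
  | addSize (x y : ℕ) : Cmd
  /-- `x := t[i, j]` -/
  | load (x t i j : ℕ) : Cmd
  /-- `t[i, j] := x` -/
  | store (t i j x : ℕ) : Cmd
  /-- `x := input[i, j]` -/
  | input (x i j : ℕ) : Cmd
  /-- `output[i] := x` -/
  | output (i x : ℕ) : Cmd
  /-- first `p`, then `q` -/
  | seq (p q : Cmd) : Cmd
  /-- `if x < y then p else q` -/
  | ifLt (x y : ℕ) (p q : Cmd) : Cmd
  /-- `for x < a * n + b do p` -/
  | loop (x a b : ℕ) (p : Cmd) : Cmd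

namespace Cmd

/-- The store after the execution of a command with size parameter `n`. -/
def eval (n : ℕ) : Cmd → Store → Store
  | skip, s => s
  | const x k, s => s.setV x k
  | addConst x y k, s => s.setV x (s.v y + k)
  | addSize x y, s => s.setV x (s.v y + n)
  | load x t i j, s => s.setV x (s.a t (s.v i) (s.v j))
  | store t i j x, s => s.setA t (s.v i) (s.v j) (s.v x)
  | input x i j, s =>
    s.setV x (if s.v i < n then if s.v j < n then s.low (s.v i * n + s.v j) else 0 else 0)
  | output i x, s =>
    if s.v i < n then { s with low := Function.update s.low (s.v i) (s.v x) } else s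
  | seq p q, s => q.eval n (p.eval n s)
  | ifLt x y p q, s => if s.v x < s.v y then p.eval n s else q.eval n s
  | loop x a b p, s => Nat.rec s (fun k s' => p.eval n (s'.setV x k)) (a * n + b)

/-- A bound for the running time of a compiled command, and for the amount by which it increases
the largest number present. -/
def cost (n : ℕ) : Cmd → ℕ
  | skip => 1
  | const _ k => k + 1
  | addConst _ _ k => k + 2
  | addSize _ _ => n + 1
  | load _ t _ _ => t + 10
  | store t _ _ _ => t + 10
  | input _ _ _ => 5
  | output _ _ => 2
  | seq p q => p.cost n + q.cost n
  | ifLt _ _ p q => 1 + p.cost n + q.cost n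
  | loop _ a b p => a + 6 + (a * n + b) * (p.cost n + 5)

end Cmd

/-- An injective polynomial pairing of natural numbers. The machine computes addresses with it, so
that no bounds on the indices of a matrix are needed. -/
def polyPair (x y : ℕ) : ℕ := (x + y) * (x + y) + y

theorem polyPair_inj {x y x' y' : ℕ} (h : polyPair x y = polyPair x' y') : x = x' ∧ y = y' := by
  have h1 : Nat.sqrt (polyPair x y) = x + y := Nat.sqrt_add_eq _ (by omega)
  have h2 : Nat.sqrt (polyPair x' y') = x' + y' := Nat.sqrt_add_eq _ (by omega)
  rw [h, h2] at h1
  unfold polyPair at h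
  rw [h1] at h
  omega

theorem polyPair_mono {x y x' y' : ℕ} (hx : x ≤ x') (hy : y ≤ y') :
    polyPair x y ≤ polyPair x' y' := by
  unfold polyPair
  gcongr

/-- The address of entry `(i, j)` of matrix `t`, above the cells of the input. -/
def cellAddress (n t i j : ℕ) : ℕ := n * n + polyPair (polyPair i j) t

/-- A bound for the addresses, and for the intermediate results of their computation, when the
numbers present are at most `b`. -/
def wordBound (b : ℕ) : ℕ := b * b + polyPair (polyPair b b) b

theorem le_polyPair_left (x y : ℕ) : x ≤ polyPair x y := by
  unfold polyPair
  nlinarith [Nat.zero_le x, Nat.zero_le y, Nat.le_mul_self (x + y)]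

theorem le_wordBound (b : ℕ) : b ≤ wordBound b :=
  (le_polyPair_left b b).trans ((le_polyPair_left _ b).trans (Nat.le_add_left _ _))

theorem cellAddress_le_wordBound {n t i j b : ℕ} (hn : n ≤ b) (ht : t ≤ b) (hi : i ≤ b)
    (hj : j ≤ b) : cellAddress n t i j ≤ wordBound b :=
  Nat.add_le_add (Nat.mul_le_mul hn hn) (polyPair_mono (polyPair_mono hi hj) ht)

namespace Cmd

/-- The machine register that holds variable `x`. Registers `1` and `2` are scratch registers, and
the odd registers from `21` on hold the counters and the bounds of loops. -/
def varReg (x : ℕ) : ℕ := 2 * x + 20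

/-- Compute the address of `t[i, j]` in register `1`. -/
def addressProg (t i j : ℕ) : RAM.Prog :=
  .seq (.add 1 (varReg i) (varReg j)) <| .seq (.mul 1 1 1) <| .seq (.add 1 1 (varReg j)) <|
  .seq (.const 2 t) <| .seq (.add 1 1 2) <| .seq (.mul 1 1 1) <| .seq (.add 1 1 2) <|
  .seq (.mul 2 0 0) (.add 1 2 1)

/-- Compilation of a command at loop depth `d`. The counter of a loop and its bound are kept in
registers of their own, so that the body may overwrite the loop variable. -/
def compile (d : ℕ) : Cmd → RAM.Prog
  | skip => .skip
  | const x k => .const (varReg x) k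
  | addConst x y k => .seq (.const 1 k) (.add (varReg x) (varReg y) 1)
  | addSize x y => .add (varReg x) (varReg y) 0
  | load x t i j => .seq (addressProg t i j) (.load (varReg x) 1)
  | store t i j x => .seq (addressProg t i j) (.store 1 (varReg x))
  | input x i j =>
    .ifLt (varReg i) 0
      (.ifLt (varReg j) 0
        (.seq (.mul 1 (varReg i) 0) (.seq (.add 1 1 (varReg j)) (.load (varReg x) 1)))
        (.const (varReg x) 0))
      (.const (varReg x) 0)
  | output i x => .ifLt (varReg i) 0 (.store (varReg i) (varReg x)) .skip
  | seq p q => .seq (p.compile d) (q.compile d)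
  | ifLt x y p q => .ifLt (varReg x) (varReg y) (p.compile d) (q.compile d)
  | loop x a b p =>
    .seq (.const (2 * d + 23) a) <| .seq (.mul (2 * d + 23) (2 * d + 23) 0) <|
    .seq (.const 1 b) <| .seq (.add (2 * d + 23) (2 * d + 23) 1) <| .seq (.const (2 * d + 21) 0) <|
    .whileLt (2 * d + 21) (2 * d + 23) <|
      .seq (.const 1 0) <| .seq (.add (varReg x) (2 * d + 21) 1) <| .seq (p.compile (d + 2)) <|
      .seq (.const 1 1) (.add (2 * d + 21) (2 * d + 21) 1)

end Cmd

/-- The machine state `σ` represents the store `s`. -/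
structure Represents (n : ℕ) (s : Store) (σ : RAM.State) : Prop where
  size : σ.reg 0 = n
  var : ∀ x, σ.reg (Cmd.varReg x) = s.v x
  mat : ∀ t i j, σ.mem (cellAddress n t i j) = s.a t i j
  low : ∀ x < n * n, σ.mem x = s.low x

/-- All numbers in the store are at most `b`. -/
structure Store.Bounded (b : ℕ) (s : Store) : Prop where
  var : ∀ x, s.v x ≤ b
  mat : ∀ t i j, s.a t i j ≤ b
  low : ∀ x, s.low x ≤ b

theorem Store.Bounded.mono {b b' : ℕ} {s : Store} (h : s.Bounded b) (hb : b ≤ b') :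
    s.Bounded b' :=
  ⟨fun x => (h.var x).trans hb, fun t i j => (h.mat t i j).trans hb, fun x => (h.low x).trans hb⟩

theorem Store.Bounded.setV {b : ℕ} {s : Store} (h : s.Bounded b) {x k : ℕ} (hk : k ≤ b) :
    (s.setV x k).Bounded b := by
  refine ⟨fun y => ?_, h.mat, h.low⟩
  simp only [Store.setV, Function.update_apply]
  split_ifs
  · exact hk
  · exact h.var y

namespace Cmd

/-- The cost of a command bounds the growth of the numbers in the store. -/
theorem eval_bounded {n b : ℕ} (hn : n ≤ b) (c : Cmd) {s : Store} (h : s.Bounded b) :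
    (c.eval n s).Bounded (b + c.cost n) := by
  induction c generalizing s b with
  | skip => exact h.mono (by omega)
  | const x k => exact (h.mono (by omega)).setV (by simp [cost]; omega)
  | addConst x y k =>
    exact (h.mono (by omega)).setV (by have := h.var y; simp only [cost]; omega)
  | addSize x y => exact (h.mono (by omega)).setV (by have := h.var y; simp only [cost]; omega)
  | load x t i j =>
    exact (h.mono (by omega)).setV (by have := h.mat t (s.v i) (s.v j); simp only [cost]; omega)
  | store t i j x =>
    refine ⟨(h.mono (by omega)).var, fun t' i' j' => ?_, (h.mono (by omega)).low⟩
    simp only [eval, Store.setA]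
    split_ifs
    · exact (h.mono (by omega)).var x
    · exact (h.mono (by omega)).mat _ _ _
  | input x i j =>
    refine (h.mono (by omega)).setV ?_
    split_ifs
    · exact (h.mono (by omega)).low _
    · omega
    · omega
  | output i x =>
    simp only [eval]
    split_ifs
    · refine ⟨(h.mono (by omega)).var, (h.mono (by omega)).mat, fun y => ?_⟩
      simp only [Function.update_apply]
      split_ifs
      · exact (h.mono (by omega)).var x
      · exact (h.mono (by omega)).low y
    · exact h.mono (by omega)
  | seq p q ihp ihq =>
    have := ihq (b := b + p.cost n) (by omega) (ihp hn h)
    exact this.mono (by simp only [cost]; omega)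
  | ifLt x y p q ihp ihq =>
    simp only [eval]
    split_ifs
    · exact (ihp hn h).mono (by simp only [cost]; omega)
    · exact (ihq hn h).mono (by simp only [cost]; omega)
  | loop x a e p ih =>
    have key : ∀ k, Store.Bounded (b + k * (p.cost n + 5))
        (Nat.rec s (fun k s' => p.eval n (s'.setV x k)) k) := by
      intro k
      induction k with
      | zero => simpa using h
      | succ k ihk =>
        refine (ih (b := b + k * (p.cost n + 5) + 1) (by omega)
          ((ihk.mono (by omega)).setV ?_)).mono ?_
        · have : k ≤ k * (p.cost n + 5) := Nat.le_mul_of_pos_right _ (by omega)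
          omega
        · rw [Nat.succ_mul]; omega
    exact (key _).mono (by simp only [cost]; omega)

theorem exec_addressProg {n b W t i j : ℕ} {s : Store} {σ : RAM.State} (hσ : Represents n s σ)
    (hs : s.Bounded b) (hn : n ≤ b) (ht : t ≤ b) (hW : wordBound b ≤ W) :
    ∃ σ', RAM.Exec W (addressProg t i j) σ 9 σ' ∧
      σ'.reg 1 = cellAddress n t (s.v i) (s.v j) ∧
      (∀ r, r ≠ 1 → r ≠ 2 → σ'.reg r = σ.reg r) ∧ σ'.mem = σ.mem := by
  have hle : cellAddress n t (s.v i) (s.v j) ≤ W :=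
    (cellAddress_le_wordBound hn ht (hs.var i) (hs.var j)).trans hW
  have h0 : t ≤ W := ht.trans ((le_wordBound b).trans hW)
  have h1 := Nat.le_mul_self (s.v i + s.v j)
  have h2 := Nat.le_mul_self ((s.v i + s.v j) * (s.v i + s.v j) + s.v j + t)
  unfold cellAddress polyPair at hle
  have hi := hσ.var i
  have hj := hσ.var j
  have hz := hσ.size
  unfold varReg at hi hj
  refine ⟨_, .seq (.add _ _ _ _ ?_) <| .seq (.mul _ _ _ _ ?_) <| .seq (.add _ _ _ _ ?_) <|
    .seq (.const _ _ _ h0) <| .seq (.add _ _ _ _ ?_) <| .seq (.mul _ _ _ _ ?_) <|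
    .seq (.add _ _ _ _ ?_) <| .seq (.mul _ _ _ _ ?_) (.add _ _ _ _ ?_), ?_, ?_, ?_⟩
  all_goals simp [RAM.State.setReg, Function.update_apply, varReg, hi, hj, hz, cellAddress,
    polyPair]
  all_goals first | omega | skip
  intro r h1 h2
  simp [h1, h2]

/-- Compilation is correct: the machine simulates a command within its cost, provided that words
can hold the addresses formed from the numbers that may occur. -/
theorem exec_compile {n W : ℕ} (c : Cmd) : ∀ {d b : ℕ} {s : Store} {σ : RAM.State},
    Represents n s σ → s.Bounded b → n ≤ b → wordBound (b + c.cost n) ≤ W →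
    ∃ t σ', RAM.Exec W (c.compile d) σ t σ' ∧ t ≤ c.cost n ∧ Represents n (c.eval n s) σ' ∧
      ∀ e < d, σ'.reg (2 * e + 21) = σ.reg (2 * e + 21) := by
  -- all commands that assign a variable end in this way, after changes of scratch registers only
  have hsetV : ∀ {s : Store} {σ σ' : RAM.State} {x k : ℕ}, Represents n s σ →
      (∀ r, r ≠ 1 → r ≠ 2 → σ'.reg r = σ.reg r) → σ'.mem = σ.mem →
      Represents n (s.setV x k) (σ'.setReg (varReg x) k) ∧
      ∀ e, (σ'.setReg (varReg x) k).reg (2 * e + 21) = σ.reg (2 * e + 21) := by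
    intro s σ σ' x k hσ hr hm
    refine ⟨⟨?_, fun y => ?_, ?_, ?_⟩, fun e => ?_⟩
    · simp [RAM.State.setReg, varReg, hr, hσ.size]
    · by_cases hxy : y = x
      · simp [RAM.State.setReg, Store.setV, hxy]
      · have : varReg y ≠ varReg x := by unfold varReg; omega
        simp only [RAM.State.setReg, Store.setV, Function.update_apply, hxy, this, if_false]
        rw [hr _ (by unfold varReg; omega) (by unfold varReg; omega), hσ.var]
    · simpa [RAM.State.setReg, hm, Store.setV] using hσ.mat
    · simpa [RAM.State.setReg, hm, Store.setV] using hσ.low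
    · have : 2 * e + 21 ≠ varReg x := by unfold varReg; omega
      simp only [RAM.State.setReg, Function.update_apply, this, if_false]
      exact hr _ (by omega) (by omega)
  induction c with
  | skip =>
    intro d b s σ hσ hs hn hW
    exact ⟨1, σ, .skip σ, le_rfl, hσ, fun _ _ => rfl⟩
  | const x k =>
    intro d b s σ hσ hs hn hW
    have hk : k ≤ W := by have := le_wordBound (b + (const x k).cost n); simp [cost] at *; omega
    have := hsetV (x := x) (k := k) hσ (σ' := σ) (fun _ _ _ => rfl) rfl
    exact ⟨1, _, .const _ _ _ hk, by simp [cost], this.1, fun e _ => this.2 e⟩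
  | addConst x y k =>
    intro d b s σ hσ hs hn hW
    have hk : b + k ≤ W := by
      have := le_wordBound (b + (addConst x y k).cost n); simp only [cost] at *; omega
    have hy := hs.var y
    have hy1 : varReg y ≠ 1 := by unfold varReg; omega
    have h := hsetV (x := x) (k := s.v y + k) hσ (σ' := σ.setReg 1 k)
      (fun r h1 _ => by simp [RAM.State.setReg, h1]) rfl
    have hval : (σ.setReg 1 k).reg (varReg y) + (σ.setReg 1 k).reg 1 = s.v y + k := by
      simp [RAM.State.setReg, hy1, hσ.var]
    refine ⟨2, _, .seq (.const _ _ _ (by omega)) (.add _ _ _ _ (by rw [hval]; omega)),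
      by simp [cost], ?_, fun e _ => ?_⟩
    · rw [hval]; exact h.1
    · rw [hval]; exact h.2 e
  | addSize x y =>
    intro d b s σ hσ hs hn hW
    have hk : b + n ≤ W := by
      have := le_wordBound (b + (addSize x y).cost n); simp only [cost] at *; omega
    have hy := hs.var y
    have h := hsetV (x := x) (k := s.v y + n) hσ (σ' := σ) (fun r h1 _ => rfl) rfl
    have hval : σ.reg (varReg y) + σ.reg 0 = s.v y + n := by rw [hσ.var, hσ.size]
    refine ⟨1, _, .add _ _ _ _ (by rw [hval]; omega), by simp [cost], ?_, fun e _ => ?_⟩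
    · rw [hval]; exact h.1
    · rw [hval]; exact h.2 e
  | load x t i j =>
    intro d b s σ hσ hs hn hW
    obtain ⟨σ', hex, h1, hr, hm⟩ := exec_addressProg (W := W) (t := t) (i := i) (j := j)
      (b := b + (load x t i j).cost n) hσ (hs.mono (by omega)) (by omega)
      (by simp only [cost]; omega) hW
    have h := hsetV (x := x) (k := s.a t (s.v i) (s.v j)) hσ hr hm
    have hval : σ'.mem (σ'.reg 1) = s.a t (s.v i) (s.v j) := by rw [h1, hm, hσ.mat]
    refine ⟨10, _, .seq hex (.load _ _ _), by simp [cost], ?_, fun e _ => ?_⟩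
    · rw [hval]; exact h.1
    · rw [hval]; exact h.2 e
  | store t i j x =>
    intro d b s σ hσ hs hn hW
    obtain ⟨σ', hex, h1, hr, hm⟩ := exec_addressProg (W := W) (t := t) (i := i) (j := j)
      (b := b + (store t i j x).cost n) hσ (hs.mono (by omega)) (by omega)
      (by simp only [cost]; omega) hW
    refine ⟨10, _, .seq hex (.store _ _ _), by simp [cost], ?_, fun e _ => ?_⟩
    · refine ⟨?_, fun y => ?_, fun t' i' j' => ?_, fun y hy => ?_⟩
      · simp [RAM.State.setMem, hr, hσ.size]
      · simp only [RAM.State.setMem]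
        rw [hr _ (by unfold varReg; omega) (by unfold varReg; omega), hσ.var]
        rfl
      · simp only [RAM.State.setMem, eval, Store.setA, Function.update_apply, h1, hm]
        rw [hr _ (by unfold varReg; omega) (by unfold varReg; omega), hσ.var, hσ.mat]
        refine if_congr ⟨fun h => ?_, ?_⟩ rfl rfl
        · obtain ⟨h2, h3⟩ := polyPair_inj (Nat.add_left_cancel h)
          exact ⟨h3, polyPair_inj h2⟩
        · rintro ⟨rfl, rfl, rfl⟩; rfl
      · have : y ≠ cellAddress n t (s.v i) (s.v j) := by unfold cellAddress; omega
        simp [RAM.State.setMem, eval, Store.setA, h1, hm, this, hσ.low y hy]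
    · exact hr _ (by omega) (by omega)
  | input x i j =>
    intro d b s σ hσ hs hn hW
    have hi := hσ.var i
    have hj := hσ.var j
    have hz := hσ.size
    have hi' : varReg i ≠ 1 := by unfold varReg; omega
    have hj' : varReg j ≠ 1 := by unfold varReg; omega
    by_cases hin : s.v i < n
    · by_cases hjn : s.v j < n
      · have hlt : s.v i * n + s.v j < n * n := by nlinarith
        have hnW : n * n ≤ W := by
          refine le_trans ?_ hW
          exact (Nat.mul_le_mul (by omega) (by omega)).trans (Nat.le_add_right _ _)
        have h := hsetV (x := x) (k := s.low (s.v i * n + s.v j)) hσ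
          (σ' := (σ.setReg 1 (s.v i * n)).setReg 1 (s.v i * n + s.v j))
          (fun r h1 _ => by simp [RAM.State.setReg, h1]) rfl
        have hex : RAM.Exec W ((input x i j).compile d) σ (1 + (1 + (1 + (1 + 1))))
            (((σ.setReg 1 (s.v i * n)).setReg 1 (s.v i * n + s.v j)).setReg (varReg x)
              (s.low (s.v i * n + s.v j))) := by
          refine .ifTrue (by rw [hi, hz]; exact hin) (.ifTrue (by rw [hj, hz]; exact hjn)
            (.seq (s' := σ.setReg 1 (s.v i * n)) ?_ (.seq
              (s' := (σ.setReg 1 (s.v i * n)).setReg 1 (s.v i * n + s.v j)) ?_ ?_)))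
          · have := RAM.Exec.mul (W := W) σ 1 (varReg i) 0 (by rw [hi, hz]; omega)
            rwa [hi, hz] at this
          · have := RAM.Exec.add (W := W) (σ.setReg 1 (s.v i * n)) 1 1 (varReg j)
              (by simp [RAM.State.setReg, hj', hj]; omega)
            simpa [RAM.State.setReg, hj', hj] using this
          · have := RAM.Exec.load (W := W)
              ((σ.setReg 1 (s.v i * n)).setReg 1 (s.v i * n + s.v j)) (varReg x) 1
            simpa [RAM.State.setReg, hσ.low _ hlt] using this
        refine ⟨_, _, hex, by simp [cost], ?_, fun e _ => h.2 e⟩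
        simpa [eval, hin, hjn] using h.1
      · have h := hsetV (x := x) (k := 0) hσ (σ' := σ) (fun r h1 _ => rfl) rfl
        refine ⟨_, _, .ifTrue (by rw [hi, hz]; exact hin) (.ifFalse (by rw [hj, hz]; exact hjn)
          (.const _ _ _ (Nat.zero_le _))), by simp [cost], ?_, fun e _ => h.2 e⟩
        simpa [eval, hin, hjn] using h.1
    · have h := hsetV (x := x) (k := 0) hσ (σ' := σ) (fun r h1 _ => rfl) rfl
      refine ⟨_, _, .ifFalse (by rw [hi, hz]; exact hin) (.const _ _ _ (Nat.zero_le _)),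
        by simp [cost], ?_, fun e _ => h.2 e⟩
      simpa [eval, hin] using h.1
  | output i x =>
    intro d b s σ hσ hs hn hW
    have hi := hσ.var i
    have hz := hσ.size
    by_cases hin : s.v i < n
    · refine ⟨_, _, .ifTrue (by rw [hi, hz]; exact hin) (.store _ _ _), by simp [cost], ?_,
        fun e _ => rfl⟩
      refine ⟨hσ.size, fun y => ?_, fun t' i' j' => ?_, fun y hy => ?_⟩
      · simp [RAM.State.setMem, eval, hin, hσ.var]
      · have : cellAddress n t' i' j' ≠ s.v i := by
          have := Nat.le_mul_self n
          unfold cellAddress; omega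
        simp [RAM.State.setMem, eval, hin, hσ.mat, hi, this]
      · simp only [RAM.State.setMem, eval, hin, if_true, Function.update_apply, hi, hσ.var,
          hσ.low y hy]
    · refine ⟨_, _, .ifFalse (by rw [hi, hz]; exact hin) (.skip _), by simp [cost], ?_,
        fun e _ => rfl⟩
      simpa [eval, hin] using hσ
  | seq p q ihp ihq =>
    intro d b s σ hσ hs hn hW
    obtain ⟨t, σ', h1, h2, h3, h4⟩ := ihp (d := d) hσ (hs.mono (Nat.le_add_right b (q.cost n)))
      (by omega) (by rw [add_assoc, add_comm (q.cost n)]; exact hW)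
    obtain ⟨t', σ'', h1', h2', h3', h4'⟩ := ihq (d := d) h3 (eval_bounded hn p hs) (by omega)
      (by rw [add_assoc]; exact hW)
    exact ⟨_, _, .seq h1 h1', Nat.add_le_add h2 h2', h3', fun e he => (h4' e he).trans (h4 e he)⟩
  | ifLt x y p q ihp ihq =>
    intro d b s σ hσ hs hn hW
    have hx := hσ.var x
    have hy := hσ.var y
    by_cases hxy : s.v x < s.v y
    · obtain ⟨t, σ', h1, h2, h3, h4⟩ := ihp (d := d) hσ
        (hs.mono (Nat.le_add_right b (1 + q.cost n))) (by omega) (by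
          have : b + (1 + q.cost n) + p.cost n = b + (ifLt x y p q).cost n := by
            simp only [cost]; omega
          rwa [this])
      refine ⟨_, _, .ifTrue (by rw [hx, hy]; exact hxy) h1, by simp only [cost]; omega, ?_, h4⟩
      simpa [eval, hxy] using h3
    · obtain ⟨t, σ', h1, h2, h3, h4⟩ := ihq (d := d) hσ
        (hs.mono (Nat.le_add_right b (1 + p.cost n))) (by omega) (by
          have : b + (1 + p.cost n) + q.cost n = b + (ifLt x y p q).cost n := by
            simp only [cost]; omega
          rwa [this])
      refine ⟨_, _, .ifFalse (by rw [hx, hy]; exact hxy) h1, by simp only [cost]; omega, ?_, h4⟩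
      simpa [eval, hxy] using h3
  | loop x a e p ih =>
    intro d b s σ hσ hs hn hW
    set N := a * n + e with hN
    set B := b + (loop x a e p).cost n with hB
    have hBW : B ≤ W := (le_wordBound B).trans hW
    have hcost : (loop x a e p).cost n = a + 6 + N * (p.cost n + 5) := rfl
    have hNc : N ≤ N * (p.cost n + 5) := Nat.le_mul_of_pos_right _ (by omega)
    let F : ℕ → Store := fun k => Nat.rec s (fun k s' => p.eval n (s'.setV x k)) k
    have hFs : ∀ k, F (k + 1) = p.eval n ((F k).setV x k) := fun k => rfl
    have hFb : ∀ k, (F k).Bounded (b + k * (p.cost n + 5)) := by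
      intro k
      induction k with
      | zero => simpa [F] using hs
      | succ k ihk =>
        rw [hFs]
        refine (eval_bounded (b := b + k * (p.cost n + 5) + 1) (by omega) p
          ((ihk.mono (by omega)).setV ?_)).mono ?_
        · have : k ≤ k * (p.cost n + 5) := Nat.le_mul_of_pos_right _ (by omega)
          omega
        · rw [Nat.succ_mul]; omega
    -- the loop from the `k`-th round on
    have hloop : ∀ m k (σ : RAM.State), k + m = N → Represents n (F k) σ →
        σ.reg (2 * d + 21) = k → σ.reg (2 * d + 23) = N →
        ∃ t σ', RAM.Exec W (.whileLt (2 * d + 21) (2 * d + 23) <|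
          .seq (.const 1 0) <| .seq (.add (varReg x) (2 * d + 21) 1) <|
          .seq (p.compile (d + 2)) <|
          .seq (.const 1 1) (.add (2 * d + 21) (2 * d + 21) 1)) σ t σ' ∧
          t ≤ m * (p.cost n + 5) + 1 ∧ Represents n (F N) σ' ∧
          ∀ e < d, σ'.reg (2 * e + 21) = σ.reg (2 * e + 21) := by
      intro m
      induction m with
      | zero =>
        intro k σ hk hσ hc hb
        refine ⟨1, σ, .whileFalse (by omega), by omega, ?_, fun _ _ => rfl⟩
        rwa [← hk]
      | succ m ihm =>
        intro k σ hk hσ hc hb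
        have h1 := hsetV (x := x) (k := k) hσ (σ' := σ.setReg 1 0)
          (fun r h1 _ => by simp [RAM.State.setReg, h1]) rfl
        have hbk : ((F k).setV x k).Bounded (b + k * (p.cost n + 5) + 1) := by
          refine ((hFb k).mono (by omega)).setV ?_
          have : k ≤ k * (p.cost n + 5) := Nat.le_mul_of_pos_right _ (by omega)
          omega
        have hkN : (k + 1) * (p.cost n + 5) ≤ N * (p.cost n + 5) :=
          Nat.mul_le_mul_right _ (by omega)
        obtain ⟨t, σ₂, h2, h3, h4, h5⟩ := ih (d := d + 2) (b := B - p.cost n) h1.1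
          (hbk.mono (by rw [Nat.succ_mul] at hkN; omega))
          (by rw [Nat.succ_mul] at hkN; omega)
          (by
            have : B - p.cost n + p.cost n = B := by rw [Nat.succ_mul] at hkN; omega
            rwa [this])
        have hc2 : σ₂.reg (2 * d + 21) = k := by rw [h5 d (by omega), h1.2, hc]
        have hb2 : σ₂.reg (2 * d + 23) = N := by
          have := h5 (d + 1) (by omega)
          rw [h1.2] at this
          rw [← hb]; exact this
        have h6 : Represents n (F (k + 1)) ((σ₂.setReg 1 1).setReg (2 * d + 21) (k + 1)) := by
          refine ⟨?_, fun y => ?_, ?_, ?_⟩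
          · simp [RAM.State.setReg, h4.size]
          · have e1 : varReg y ≠ 2 * d + 21 := by unfold varReg; omega
            have e2 : varReg y ≠ 1 := by unfold varReg; omega
            simp only [RAM.State.setReg, Function.update_apply, e1, e2, if_false]
            exact h4.var y
          · simpa [RAM.State.setReg] using h4.mat
          · simpa [RAM.State.setReg] using h4.low
        obtain ⟨t', σ', h7, h8, h9, h10⟩ := ihm (k + 1) _ (by omega) h6
          (by simp [RAM.State.setReg]) (by simp [RAM.State.setReg, hb2])
        have hbody : RAM.Exec W (.seq (.const 1 0) <| .seq (.add (varReg x) (2 * d + 21) 1) <|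
            .seq (p.compile (d + 2)) <| .seq (.const 1 1) (.add (2 * d + 21) (2 * d + 21) 1)) σ
            (1 + (1 + (t + (1 + 1)))) ((σ₂.setReg 1 1).setReg (2 * d + 21) (k + 1)) := by
          refine .seq (.const _ _ _ (Nat.zero_le _)) (.seq ?_ (.seq h2 (.seq
            (.const _ _ _ (by rw [Nat.succ_mul] at hkN; omega)) ?_)))
          · have := RAM.Exec.add (W := W) (σ.setReg 1 0) (varReg x) (2 * d + 21) 1
              (by simp [RAM.State.setReg, hc]; omega)
            simpa [RAM.State.setReg, hc] using this
          · have := RAM.Exec.add (W := W) (σ₂.setReg 1 1) (2 * d + 21) (2 * d + 21) 1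
              (by simp [RAM.State.setReg, hc2]; omega)
            simpa [RAM.State.setReg, hc2] using this
        refine ⟨_, _, .whileTrue (by omega) hbody h7, by rw [Nat.succ_mul]; omega, h9,
          fun e he => ?_⟩
        rw [h10 e he]
        have : e ≠ d := by omega
        simp only [RAM.State.setReg, Function.update_apply, Nat.add_right_cancel_iff,
          mul_eq_mul_left_iff, this, OfNat.ofNat_ne_zero, or_self, if_false]
        rw [if_neg (by omega), h5 e (by omega), h1.2]
    set σ₁ : RAM.State := ((((σ.setReg (2 * d + 23) a).setReg (2 * d + 23) (a * n)).setReg 1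
      e).setReg (2 * d + 23) N).setReg (2 * d + 21) 0 with hσ₁
    have h1 : Represents n (F 0) σ₁ := by
      refine ⟨?_, fun y => ?_, ?_, ?_⟩
      · simp [hσ₁, RAM.State.setReg, hσ.size]
      · have e1 : varReg y ≠ 2 * d + 21 := by unfold varReg; omega
        have e2 : varReg y ≠ 1 := by unfold varReg; omega
        have e3 : varReg y ≠ 2 * d + 23 := by unfold varReg; omega
        simp only [hσ₁, RAM.State.setReg, Function.update_apply, e1, e2, e3, if_false]
        exact hσ.var y
      · simpa [hσ₁, RAM.State.setReg, F] using hσ.mat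
      · simpa [hσ₁, RAM.State.setReg, F] using hσ.low
    obtain ⟨t, σ', h2, h3, h4, h5⟩ := hloop N 0 σ₁ (by omega) h1
      (by simp [hσ₁, RAM.State.setReg]) (by simp [hσ₁, RAM.State.setReg])
    refine ⟨1 + (1 + (1 + (1 + (1 + t)))), σ', ?_, by rw [hcost]; omega, h4, fun e he => ?_⟩
    · refine .seq (.const _ _ _ (by omega)) (.seq (s' := (σ.setReg (2 * d + 23) a).setReg
        (2 * d + 23) (a * n)) ?_ (.seq (.const _ _ _ (by omega)) (.seq
        (s' := (((σ.setReg (2 * d + 23) a).setReg (2 * d + 23) (a * n)).setReg 1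
          e).setReg (2 * d + 23) N) ?_ (.seq (.const _ _ _ (by omega)) h2))))
      · have := RAM.Exec.mul (W := W) (σ.setReg (2 * d + 23) a) (2 * d + 23) (2 * d + 23) 0
          (by simp [RAM.State.setReg, hσ.size]; omega)
        simpa [RAM.State.setReg, hσ.size] using this
      · have := RAM.Exec.add (W := W) (((σ.setReg (2 * d + 23) a).setReg (2 * d + 23)
          (a * n)).setReg 1 e) (2 * d + 23) (2 * d + 23) 1
          (by simp [RAM.State.setReg]; omega)
        simpa [RAM.State.setReg, hN] using this
    · rw [h5 e he]
      have e1 : 2 * e + 21 ≠ 2 * d + 21 := by omega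
      have e3 : 2 * e + 21 ≠ 2 * d + 23 := by omega
      simp only [hσ₁, RAM.State.setReg, Function.update_apply, e1, e3, if_false]
      rw [if_neg (by omega)]

end Cmd

/-! ### Bipartite matchings and certificates of maximality -/

/-- The assignment `m` is a matching of rows `r < n` to the numbers `1, …, k` along edges of `G`.
The value `0` marks a free row; values at `r ≥ n` are irrelevant. -/
structure IsMatching (n k : ℕ) (G : ℕ → ℕ → Prop) (m : ℕ → ℕ) : Prop where
  le : ∀ r < n, m r ≤ k
  edge : ∀ r < n, m r ≠ 0 → G r (m r)
  inj : ∀ r < n, ∀ r' < n, m r ≠ 0 → m r = m r' → r = r'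

open Classical in
/-- The rows `r < n` adjacent to an element of `Y`. -/
noncomputable def rowNeighbors (n : ℕ) (G : ℕ → ℕ → Prop) (Y : Finset ℕ) : Finset ℕ :=
  (Finset.range n).filter fun r => ∃ z ∈ Y, G r z

/-- The rows `r < n` matched by `m`. -/
def matchedRows (n : ℕ) (m : ℕ → ℕ) : Finset ℕ :=
  (Finset.range n).filter fun r => m r ≠ 0

/-- A set `Y` of left vertices that shows, in the manner of König's theorem, that no matching of
`1, …, k` is larger than `m`. -/
def IsCertificate (n k : ℕ) (G : ℕ → ℕ → Prop) (m : ℕ → ℕ) (Y : Finset ℕ) : Prop :=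
  Y ⊆ Finset.Icc 1 k ∧
    (rowNeighbors n G Y).card + (Finset.Icc 1 k \ Y).card ≤ (matchedRows n m).card

theorem mem_rowNeighbors {n : ℕ} {G : ℕ → ℕ → Prop} {Y : Finset ℕ} {r : ℕ} :
    r ∈ rowNeighbors n G Y ↔ r < n ∧ ∃ z ∈ Y, G r z := by
  simp [rowNeighbors]

theorem mem_matchedRows {n : ℕ} {m : ℕ → ℕ} {r : ℕ} :
    r ∈ matchedRows n m ↔ r < n ∧ m r ≠ 0 := by
  simp [matchedRows]

theorem IsMatching.congr {n k : ℕ} {G : ℕ → ℕ → Prop} {m m' : ℕ → ℕ} (h : IsMatching n k G m)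
    (hm : ∀ r < n, m' r = m r) : IsMatching n k G m' :=
  ⟨fun r hr => by rw [hm r hr]; exact h.le r hr,
    fun r hr h0 => by rw [hm r hr] at h0 ⊢; exact h.edge r hr h0,
    fun r hr r' hr' h0 he => by
      rw [hm r hr] at h0 he
      rw [hm r' hr'] at he
      exact h.inj r hr r' hr' h0 he⟩

theorem matchedRows_congr {n : ℕ} {m m' : ℕ → ℕ} (hm : ∀ r < n, m' r = m r) :
    matchedRows n m' = matchedRows n m := by
  unfold matchedRows
  exact Finset.filter_congr fun r hr => by rw [hm r (Finset.mem_range.1 hr)]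

/-- Any matching, given by its set of edges, is at most as large as one with a certificate. -/
theorem IsCertificate.card_le {n k : ℕ} {G : ℕ → ℕ → Prop} {m : ℕ → ℕ} {Y : Finset ℕ}
    (hY : IsCertificate n k G m Y) {ε : Type*} (T : Finset ε) (left row : ε → ℕ)
    (hleft : Set.InjOn left T) (hrow : Set.InjOn row T)
    (hT : ∀ e ∈ T, left e ∈ Finset.Icc 1 k ∧ row e < n ∧ G (row e) (left e)) :
    T.card ≤ (matchedRows n m).card := by
  classical
  rw [← Finset.card_filter_add_card_filter_not (s := T) fun e => left e ∈ Y]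
  refine le_trans (Nat.add_le_add ?_ ?_) hY.2
  · refine Finset.card_le_card_of_injOn row (fun e he => ?_) (hrow.mono (Finset.filter_subset _ _))
    obtain ⟨he, hy⟩ := Finset.mem_filter.1 he
    exact mem_rowNeighbors.2 ⟨(hT e he).2.1, _, hy, (hT e he).2.2⟩
  · refine Finset.card_le_card_of_injOn left (fun e he => ?_)
      (hleft.mono (Finset.filter_subset _ _))
    obtain ⟨he, hy⟩ := Finset.mem_filter.1 he
    exact Finset.mem_coe.2 (Finset.mem_sdiff.2 ⟨(hT e he).1, hy⟩)

/-- The result of the search for alternating paths from the left vertex `m n`, which is treated as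
the partner of an additional row `n`: a set `vis` of rows containing `n`, where each row `r ≠ n`
has a parent `par r` of smaller depth, whose partner is adjacent to `r`. -/
structure IsSearchTree (n : ℕ) (G : ℕ → ℕ → Prop) (m : ℕ → ℕ) (vis : ℕ → Prop) (par d : ℕ → ℕ) :
    Prop where
  root : vis n
  le : ∀ r, vis r → r ≤ n
  parent : ∀ r, vis r → r ≠ n → vis (par r) ∧ d (par r) < d r ∧ G r (m (par r))

/-- The search has found everything that can be reached. -/
def SearchClosed (n : ℕ) (G : ℕ → ℕ → Prop) (m : ℕ → ℕ) (vis : ℕ → Prop) : Prop :=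
  ∀ p, vis p → ∀ r < n, G r (m p) → vis r

/-- If the search from `k + 1` reaches no free row, the partners of the rows reached are a set `Z`
with fewer neighbors than elements. By submodularity of the number of neighbors, adding `Z` to a
certificate for `1, …, k` makes it one for `1, …, k + 1`. -/
theorem IsCertificate.extend_of_search_failed {n k : ℕ} {G : ℕ → ℕ → Prop} {m : ℕ → ℕ}
    {Y : Finset ℕ} (hY : IsCertificate n k G m Y) (hm : IsMatching n k G m) (hmn : m n = k + 1)
    {vis : ℕ → Prop} {par d : ℕ → ℕ} (hv : IsSearchTree n G m vis par d)
    (hcl : SearchClosed n G m vis) (hfree : ∀ r < n, vis r → m r ≠ 0) :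
    ∃ Y', IsCertificate n (k + 1) G m Y' := by
  classical
  set V := (Finset.range n).filter vis with hV
  have hVmem : ∀ r, r ∈ V ↔ r < n ∧ vis r := by simp [hV]
  have hinj : Set.InjOn m V := fun a ha b hb hab =>
    hm.inj a ((hVmem a).1 ha).1 b ((hVmem b).1 hb).1
      (hfree a ((hVmem a).1 ha).1 ((hVmem a).1 ha).2) hab
  set Z' := V.image m with hZ'
  have hZ'card : Z'.card = V.card := Finset.card_image_of_injOn hinj
  have hZ'le : Z' ⊆ Finset.Icc 1 k := by
    intro z hz
    obtain ⟨r, hr, rfl⟩ := Finset.mem_image.1 hz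
    have h1 := (hVmem r).1 hr
    have h2 := hfree r h1.1 h1.2
    have h3 := hm.le r h1.1
    exact Finset.mem_Icc.2 ⟨by omega, h3⟩
  have hk : k + 1 ∉ Finset.Icc 1 k := by simp
  have hkZ' : k + 1 ∉ Z' := fun h => hk (hZ'le h)
  have hkY : k + 1 ∉ Y := fun h => hk (hY.1 h)
  set Z := insert (k + 1) Z' with hZ
  have hNZ : rowNeighbors n G Z ⊆ V := by
    intro r hr
    obtain ⟨hrn, z, hz, hG⟩ := mem_rowNeighbors.1 hr
    refine (hVmem r).2 ⟨hrn, ?_⟩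
    rcases Finset.mem_insert.1 hz with rfl | hz
    · exact hcl n hv.root r hrn (hmn ▸ hG)
    · obtain ⟨p, hp, rfl⟩ := Finset.mem_image.1 hz
      exact hcl p ((hVmem p).1 hp).2 r hrn hG
  have hNYZ : (Y ∩ Z').card ≤ (rowNeighbors n G Y ∩ rowNeighbors n G Z).card := by
    have hsub : Y ∩ Z' ⊆ (rowNeighbors n G Y ∩ rowNeighbors n G Z).image m := by
      intro z hz
      obtain ⟨hzY, hzZ⟩ := Finset.mem_inter.1 hz
      obtain ⟨p, hp, rfl⟩ := Finset.mem_image.1 hzZ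
      have h1 := (hVmem p).1 hp
      have hG := hm.edge p h1.1 (hfree p h1.1 h1.2)
      refine Finset.mem_image.2 ⟨p, Finset.mem_inter.2 ⟨?_, ?_⟩, rfl⟩
      · exact mem_rowNeighbors.2 ⟨h1.1, _, hzY, hG⟩
      · exact mem_rowNeighbors.2 ⟨h1.1, _, Finset.mem_insert_of_mem hzZ, hG⟩
    exact (Finset.card_le_card hsub).trans Finset.card_image_le
  have hun : rowNeighbors n G (Y ∪ Z) = rowNeighbors n G Y ∪ rowNeighbors n G Z := by
    ext r
    simp only [mem_rowNeighbors, Finset.mem_union, or_and_right, exists_or, and_or_left]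
  refine ⟨Y ∪ Z, Finset.union_subset (hY.1.trans (Finset.Icc_subset_Icc_right (by omega)))
    (Finset.insert_subset (by simp) (hZ'le.trans (Finset.Icc_subset_Icc_right (by omega)))), ?_⟩
  have hIcc : Finset.Icc 1 (k + 1) \ (Y ∪ Z) = (Finset.Icc 1 k \ Y) \ Z' := by
    ext z
    simp only [hZ, Finset.mem_sdiff, Finset.mem_Icc, Finset.mem_union, Finset.mem_insert, not_or]
    constructor
    · rintro ⟨⟨h1, h2⟩, h3, h4, h5⟩
      exact ⟨⟨⟨h1, by omega⟩, h3⟩, h5⟩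
    · rintro ⟨⟨⟨h1, h2⟩, h3⟩, h5⟩
      exact ⟨⟨h1, by omega⟩, h3, by omega, h5⟩
  have h1 := Finset.card_union_add_card_inter (rowNeighbors n G Y) (rowNeighbors n G Z)
  have h2 := Finset.card_le_card hNZ
  have h3 := Finset.card_sdiff_add_card_inter (Finset.Icc 1 k \ Y) Z'
  have h4 : (Finset.Icc 1 k \ Y) ∩ Z' = Z' \ Y := by
    ext z
    simp only [Finset.mem_inter, Finset.mem_sdiff]
    exact ⟨fun h => ⟨h.2, h.1.2⟩, fun h => ⟨⟨hZ'le h.1, h.2⟩, h.1⟩⟩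
  have h5 := Finset.card_sdiff_add_card_inter Z' Y
  rw [Finset.inter_comm] at h5
  have h6 := hY.2
  rw [hun, hIcc]
  rw [h4] at h3
  omega

/-- A certificate for `1, …, k` is one for `1, …, k + 1` and a matching larger by one. -/
theorem IsCertificate.extend_of_augmented {n k : ℕ} {G : ℕ → ℕ → Prop} {m m' : ℕ → ℕ}
    {Y : Finset ℕ} (hY : IsCertificate n k G m Y)
    (hm' : (matchedRows n m').card = (matchedRows n m).card + 1) :
    IsCertificate n (k + 1) G m' Y := by
  refine ⟨hY.1.trans (Finset.Icc_subset_Icc_right (by omega)), ?_⟩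
  have h1 : Finset.Icc 1 (k + 1) \ Y ⊆ insert (k + 1) (Finset.Icc 1 k \ Y) := by
    intro z
    simp only [Finset.mem_sdiff, Finset.mem_Icc, Finset.mem_insert]
    rintro ⟨⟨h1, h2⟩, h3⟩
    by_cases h : z = k + 1
    · exact Or.inl h
    · exact Or.inr ⟨⟨h1, by omega⟩, h3⟩
  have h2 := (Finset.card_le_card h1).trans (Finset.card_insert_le _ _)
  have h3 := hY.2
  rw [hm']
  omega

/-- The state of an augmentation along the path of parents. All rows up to `n` except the row `q`,
whose partner has been handed on, are matched as in a matching of `1, …, k`, where row `n` holds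
the left vertex to be matched; `c` of them are not free. -/
structure IsAugmenting (n k c : ℕ) (G : ℕ → ℕ → Prop) (vis : ℕ → Prop) (par d : ℕ → ℕ)
    (m : ℕ → ℕ) (q : ℕ) : Prop where
  mem : vis q
  le : ∀ r ≤ n, r ≠ q → m r ≤ k
  edge : ∀ r < n, r ≠ q → m r ≠ 0 → G r (m r)
  inj : ∀ r ≤ n, ∀ r' ≤ n, r ≠ q → r' ≠ q → m r ≠ 0 → m r = m r' → r = r'
  card : (((Finset.range (n + 1)).erase q).filter fun r => m r ≠ 0).card = c
  parent : ∀ r, vis r → r ≠ n → d r ≤ d q → vis (par r) ∧ d (par r) < d r ∧ G r (m (par r))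

theorem IsSearchTree.isAugmenting {n k : ℕ} {G : ℕ → ℕ → Prop} {m : ℕ → ℕ}
    (hm : IsMatching n k G m) (hmn : m n = k + 1)
    {vis : ℕ → Prop} {par d : ℕ → ℕ} (hv : IsSearchTree n G m vis par d) {q : ℕ} (hq : vis q)
    (hqn : q < n) (hmq : m q = 0) :
    IsAugmenting n (k + 1) ((matchedRows n m).card + 1) G vis par d m q where
  mem := hq
  le r hr _ := by
    rcases Nat.lt_or_eq_of_le hr with h | rfl
    · exact (hm.le r h).trans (by omega)
    · exact hmn.le
  edge r hr _ h := hm.edge r hr h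
  inj r hr r' hr' _ _ h0 h := by
    rcases Nat.lt_or_eq_of_le hr with h1 | rfl <;> rcases Nat.lt_or_eq_of_le hr' with h2 | rfl
    · exact hm.inj r h1 r' h2 h0 h
    · have := hm.le r h1; omega
    · have := hm.le r' h2; omega
    · rfl
  card := by
    have : ((Finset.range (n + 1)).erase q).filter (fun r => m r ≠ 0) =
        insert n (matchedRows n m) := by
      ext r
      simp only [Finset.mem_filter, Finset.mem_erase, Finset.mem_range, Finset.mem_insert,
        mem_matchedRows]
      constructor
      · rintro ⟨⟨h1, h2⟩, h3⟩
        by_cases h : r = n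
        · exact Or.inl h
        · exact Or.inr ⟨by omega, h3⟩
      · rintro (rfl | ⟨h1, h2⟩)
        · exact ⟨⟨by omega, by omega⟩, by omega⟩
        · exact ⟨⟨fun h => h2 (h ▸ hmq), by omega⟩, h2⟩
    rw [this, Finset.card_insert_of_notMem (by simp [mem_matchedRows])]
  parent r h1 h2 _ := hv.parent r h1 h2

/-- One step of the augmentation: `q` receives the partner of its parent. -/
theorem IsAugmenting.step {n k c : ℕ} {G : ℕ → ℕ → Prop} {vis : ℕ → Prop} {par d m : ℕ → ℕ}
    {q : ℕ} (h : IsAugmenting n k c G vis par d m q) (hvis : ∀ r, vis r → r ≤ n) (hq : q ≠ n)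
    (hG : ∀ r, ¬ G r 0) :
    IsAugmenting n k c G vis par d (Function.update m q (m (par q))) (par q) := by
  obtain ⟨h1, h2, h3⟩ := h.parent q h.mem hq le_rfl
  have hqn : q < n := lt_of_le_of_ne (hvis q h.mem) hq
  have hpq : par q ≠ q := fun h => by rw [h] at h2; omega
  have hpn := hvis _ h1
  have hmp : m (par q) ≠ 0 := fun h0 => hG q (h0 ▸ h3)
  refine ⟨h1, fun r hr hrp => ?_, fun r hr hrp hr0 => ?_, fun r hr r' hr' hrp hrp' h0 heq => ?_,
    ?_, fun r hr hrn hd => ?_⟩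
  · by_cases hrq : r = q
    · subst hrq
      simpa using h.le _ hpn hpq
    · simpa [hrq] using h.le r hr hrq
  · by_cases hrq : r = q
    · subst hrq
      simpa using h3
    · simp only [Function.update_of_ne hrq] at hr0 ⊢
      exact h.edge r hr hrq hr0
  · by_cases hrq : r = q <;> by_cases hrq' : r' = q
    · rw [hrq, hrq']
    · subst hrq
      simp only [Function.update_self, Function.update_of_ne hrq'] at h0 heq
      exact absurd (h.inj _ hpn r' hr' hpq hrq' h0 heq).symm hrp'
    · subst hrq'
      simp only [Function.update_self, Function.update_of_ne hrq] at h0 heq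
      exact absurd (h.inj r hr _ hpn hrq hpq h0 heq) hrp
    · simp only [Function.update_of_ne hrq, Function.update_of_ne hrq'] at h0 heq
      exact h.inj r hr r' hr' hrq hrq' h0 heq
  · rw [← h.card]
    have : ((Finset.range (n + 1)).erase (par q)).filter
        (fun r => Function.update m q (m (par q)) r ≠ 0) =
        insert q ((((Finset.range (n + 1)).erase q).filter fun r => m r ≠ 0).erase (par q)) := by
      ext r
      by_cases hrq : r = q
      · subst hrq
        simp [hpq.symm, hmp]
        omega
      · simp only [Finset.mem_filter, Finset.mem_erase, Finset.mem_insert, hrq, false_or,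
          Function.update_of_ne hrq, ne_eq, not_false_eq_true, true_and]
        tauto
    have hmem : par q ∈ ((Finset.range (n + 1)).erase q).filter fun r => m r ≠ 0 := by
      simp [hpq, hmp]; omega
    rw [this, Finset.card_insert_of_notMem (by simp), Finset.card_erase_add_one hmem]
  · obtain ⟨h4, h5, h6⟩ := h.parent r hr hrn (by omega)
    have : par r ≠ q := fun h => by rw [h] at h5; omega
    exact ⟨h4, h5, by rwa [Function.update_of_ne this]⟩

/-- When the row without partner is the additional one, the augmentation is complete. -/
theorem IsAugmenting.isMatching {n k c : ℕ} {G : ℕ → ℕ → Prop} {vis : ℕ → Prop}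
    {par d m : ℕ → ℕ} (h : IsAugmenting n k c G vis par d m n) :
    IsMatching n k G m ∧ (matchedRows n m).card = c := by
  refine ⟨⟨fun r hr => h.le r hr.le hr.ne, fun r hr => h.edge r hr hr.ne,
    fun r hr r' hr' => h.inj r hr.le r' hr'.le hr.ne hr'.ne⟩, ?_⟩
  rw [← h.card]
  congr 1
  ext r
  simp only [mem_matchedRows, Finset.mem_filter, Finset.mem_erase, Finset.mem_range]
  exact ⟨fun h => ⟨⟨by omega, by omega⟩, h.2⟩, fun h => ⟨by omega, h.2⟩⟩

/-! ### The minimum selection from a maximum matching -/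

section Selection

variable {n : ℕ} (SA : StructPattern (Fin n) (Fin n))

/-- The pattern as a relation between natural numbers. -/
def patternRel (i j : ℕ) : Prop :=
  ∃ (hi : i < n) (hj : j < n), SA ⟨i, hi⟩ ⟨j, hj⟩ = true

/-- State `i` acts on state `j`, directly or through other states. -/
def Reaches (i j : ℕ) : Prop :=
  i < n ∧ Relation.ReflTransGen (fun u v => patternRel SA v u) i j

/-- `v` is the least element of a strongly connected component without arcs from outside. -/
def IsSource (v : ℕ) : Prop :=
  v < n ∧ ∀ u, Reaches SA u v → Reaches SA v u ∧ v ≤ u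

/-- The bipartite graph of rows `r < n` and left vertices `1, …, 2 * n`: the vertex `j + 1` stands
for the column `j`, and the vertex `n + 1 + v` for the source component of `v`, of which it is
adjacent to all elements. -/
def selectionGraph (r z : ℕ) : Prop :=
  (∃ j, z = j + 1 ∧ patternRel SA r j) ∨ ∃ v, z = n + 1 + v ∧ IsSource SA v ∧ Reaches SA r v

open Classical in
/-- The states selected by a matching: those not matched to a column, and one of each source
component that the matching leaves out. -/
noncomputable def selectedStates (m : ℕ → ℕ) : Finset (Fin n) :=
  Finset.univ.filter fun i =>
    m i = 0 ∨ n < m i ∨ (IsSource SA i ∧ ∀ r < n, m r ≠ n + 1 + i)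

variable {SA}

theorem Reaches.lt_right {i j : ℕ} (h : Reaches SA i j) : j < n := by
  obtain ⟨hi, h⟩ := h
  induction h with
  | refl => exact hi
  | tail _ hjk _ => exact hjk.1

theorem Reaches.trans {i j k : ℕ} (h : Reaches SA i j) (h' : Reaches SA j k) : Reaches SA i k :=
  ⟨h.1, h.2.trans h'.2⟩

theorem Reaches.refl {i : ℕ} (h : i < n) : Reaches SA i i :=
  ⟨h, .refl⟩

theorem IsSource.eq_of_reaches {v v' j : ℕ} (hv : IsSource SA v) (hv' : IsSource SA v')
    (h : Reaches SA j v) (h' : Reaches SA j v') : v = v' := by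
  have h1 := (hv.2 j h).1.trans h'
  have h2 := (hv'.2 j h').1.trans h
  exact le_antisymm (hv.2 _ h2).2 (hv'.2 _ h1).2

/-- Every state is reached from a source component. -/
theorem exists_isSource_reaches {i : ℕ} (hi : i < n) : ∃ v, IsSource SA v ∧ Reaches SA v i := by
  classical
  let pred : ℕ → Finset ℕ := fun v => (Finset.range n).filter fun u => Reaches SA u v
  have hpred : ∀ u v, u ∈ pred v ↔ Reaches SA u v := by
    intro u v
    simp only [pred, Finset.mem_filter, Finset.mem_range]
    exact ⟨fun h => h.2, fun h => ⟨h.1, h⟩⟩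
  -- a predecessor of `i` with as few predecessors as possible
  obtain ⟨s, hs, hmin⟩ := Finset.exists_min_image (pred i) (fun v => (pred v).card)
    ⟨i, (hpred _ _).2 (Reaches.refl hi)⟩
  have hsi := (hpred _ _).1 hs
  have hback : ∀ u, Reaches SA u s → Reaches SA s u := by
    intro u hu
    have hsub : pred u ⊆ pred s := fun w hw => (hpred _ _).2 (((hpred _ _).1 hw).trans hu)
    have heq := Finset.eq_of_subset_of_card_le hsub (hmin u ((hpred _ _).2 (hu.trans hsi)))
    exact (hpred _ _).1 (heq ▸ (hpred _ _).2 (Reaches.refl hsi.1))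
  obtain ⟨v, hv, hvmin⟩ := Finset.exists_min_image (pred s) id
    ⟨s, (hpred _ _).2 (Reaches.refl hsi.1)⟩
  have hvs := (hpred _ _).1 hv
  refine ⟨v, ⟨hvs.1, fun u hu => ⟨hvs.trans (hback u (hu.trans hvs)), ?_⟩⟩, hvs.trans hsi⟩
  exact hvmin u ((hpred _ _).2 (hu.trans hvs))

theorem Reaches.mem_of_closed {S : Set (Fin n)}
    (hcl : ∀ i ∈ S, ∀ j, SA i j = true → j ∈ S) {i j : ℕ} (h : Reaches SA i j) :
    ∀ hj : j < n, ⟨j, hj⟩ ∈ S → ⟨i, h.1⟩ ∈ S := by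
  obtain ⟨hi, h⟩ := h
  induction h with
  | refl => intro _ h; exact h
  | tail _ hjk ih =>
    intro hk hkS
    obtain ⟨-, hj, hkj⟩ := hjk
    exact ih hj (hcl _ hkS _ hkj)

/-- Unselected states have distinct columns, and each source component contains a selected state. -/
theorem structurallyControllable_selectedStates {m : ℕ → ℕ}
    (hm : IsMatching n (2 * n) (selectionGraph SA) m) :
    StructurallyControllable SA
      (selectColumns (identityPattern n) (selectedStates SA m)) := by
  classical
  rw [structurallyControllable_iff]
  constructor
  · have hcol : ∀ i : Fin n, i ∉ selectedStates SA m →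
        ∃ j : Fin n, m i = j + 1 ∧ SA i j = true := by
      intro i hi
      simp only [selectedStates, Finset.mem_filter, Finset.mem_univ, true_and, not_or] at hi
      rcases hm.edge i i.2 hi.1 with ⟨j, hj, _, hjn, hij⟩ | ⟨v, hv, -⟩
      · exact ⟨⟨j, hjn⟩, hj, hij⟩
      · omega
    choose! f hf using hcol
    refine ⟨f, fun a ha b hb hab => Fin.ext (hm.inj a a.2 b b.2 ?_ ?_), fun i hi => (hf i hi).2⟩
    · rw [(hf a ha).1]; omega
    · rw [(hf a ha).1, (hf b hb).1, hab]
  · rintro S ⟨i, hi⟩ hcl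
    obtain ⟨v, hv, hvi⟩ := exists_isSource_reaches (SA := SA) i.2
    have hvS := hvi.mem_of_closed hcl i.2 hi
    by_cases hr : ∃ r < n, m r = n + 1 + v
    · obtain ⟨r, hrn, hr⟩ := hr
      refine ⟨⟨r, hrn⟩, ?_, ?_⟩
      · simp only [selectedStates, Finset.mem_filter, Finset.mem_univ, true_and]
        exact Or.inr (Or.inl (show n < m r by omega))
      · rcases hm.edge r hrn (by omega) with ⟨j, hj, -, hjn, -⟩ | ⟨v', hv', -, hrv⟩
        · omega
        · have : v' = v := by omega
          subst this
          exact hrv.mem_of_closed hcl hv.1 hvS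
    · push Not at hr
      refine ⟨⟨v, hv.1⟩, ?_, hvS⟩
      simp only [selectedStates, Finset.mem_filter, Finset.mem_univ, true_and]
      exact Or.inr (Or.inr ⟨hv, hr⟩)

variable (SA) in
open Classical in
/-- The set of representatives of the source components. -/
noncomputable def sources : Finset ℕ := (Finset.range n).filter (IsSource SA)

theorem mem_sources {v : ℕ} : v ∈ sources SA ↔ IsSource SA v := by
  simp only [sources, Finset.mem_filter, Finset.mem_range]
  exact ⟨fun h => h.2, fun h => ⟨h.1, h⟩⟩

/-- The matched source vertices save one selected state each. -/
theorem card_selectedStates_le {m : ℕ → ℕ}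
    (hm : IsMatching n (2 * n) (selectionGraph SA) m) :
    (selectedStates SA m).card + (matchedRows n m).card ≤ n + (sources SA).card := by
  classical
  set F := (Finset.range n).filter fun r => m r = 0
  set H := (Finset.range n).filter fun r => n < m r
  set U := (sources SA).filter fun v => ∀ r < n, m r ≠ n + 1 + v
  have h1 : (selectedStates SA m).card ≤ F.card + H.card + U.card := by
    rw [← Finset.card_map Fin.valEmbedding]
    refine (Finset.card_le_card (t := F ∪ H ∪ U) fun r hr => ?_).trans
      ((Finset.card_union_le _ _).trans (Nat.add_le_add_right (Finset.card_union_le _ _) _))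
    obtain ⟨i, hi, rfl⟩ := Finset.mem_map.1 hr
    simp only [selectedStates, Finset.mem_filter, Finset.mem_univ, true_and] at hi
    simp only [F, H, U, Finset.mem_union, Finset.mem_filter, Finset.mem_range, mem_sources,
      Fin.valEmbedding_apply, i.2, true_and]
    tauto
  have h2 : F.card + (matchedRows n m).card = n := by
    have := Finset.card_filter_add_card_filter_not (s := Finset.range n) fun r => m r = 0
    simpa [F, matchedRows] using this
  have h3 : H.card + U.card ≤ (sources SA).card := by
    have := Finset.card_filter_add_card_filter_not (s := sources SA)
      fun v => ∀ r < n, m r ≠ n + 1 + v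
    suffices H.card ≤ ((sources SA).filter fun v => ¬ ∀ r < n, m r ≠ n + 1 + v).card by
      simp only [U]; omega
    refine Finset.card_le_card_of_injOn (fun r => m r - (n + 1)) (fun r hr => ?_)
      (fun a ha b hb hab => ?_)
    · obtain ⟨hrn, hr⟩ := Finset.mem_filter.1 (Finset.mem_coe.1 hr)
      rw [Finset.mem_range] at hrn
      rcases hm.edge r hrn (by omega) with ⟨j, hj, -, hjn, -⟩ | ⟨v, hv, hvS, -⟩
      · omega
      · refine Finset.mem_coe.2 (Finset.mem_filter.2 ⟨?_, fun h => h r hrn (by simp only; omega)⟩)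
        have : m r - (n + 1) = v := by omega
        exact mem_sources.2 (show IsSource SA (m r - (n + 1)) by rwa [this])
    · simp only [H, Finset.coe_filter, Finset.mem_range, Set.mem_ofPred_eq] at ha hb
      simp only at hab
      exact hm.inj a ha.1 b hb.1 (by omega) (by omega)
  omega

/-- The rows outside a feasible selection, matched to columns, and the selected states that reach
the source components form a matching of the selection graph. -/
theorem card_add_card_sources_le {m : ℕ → ℕ} {Y : Finset ℕ}
    (hY : IsCertificate n (2 * n) (selectionGraph SA) m Y) {J : Finset (Fin n)}
    (hJ : StructurallyControllable SA (selectColumns (identityPattern n) J)) :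
    n + (sources SA).card ≤ J.card + (matchedRows n m).card := by
  classical
  obtain ⟨⟨f, hf, hfSA⟩, hr⟩ := structurallyControllable_iff.1 hJ
  have hreach : ∀ v, IsSource SA v → ∃ j : ℕ, (∃ hj : j < n, ⟨j, hj⟩ ∈ J) ∧ Reaches SA j v := by
    intro v hv
    obtain ⟨j, hj, hjv⟩ := hr {u | Reaches SA u v} ⟨⟨v, hv.1⟩, Reaches.refl hv.1⟩
      (fun i (hi : Reaches SA i v) j hij =>
        (show Reaches SA j v from
          ⟨j.2, .head ⟨i.2, j.2, hij⟩ hi.2⟩))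
    exact ⟨j, ⟨j.2, hj⟩, hjv⟩
  choose! g hgJ hg using hreach
  have key := hY.card_le ((Finset.univ \ J).disjSum (sources SA))
    (Sum.elim (fun i => (f i : ℕ) + 1) fun v => n + 1 + v)
    (Sum.elim (fun i => (i : ℕ)) g) ?_ ?_ ?_
  · rw [Finset.card_disjSum, Finset.card_sdiff_of_subset (Finset.subset_univ _),
      Finset.card_univ, Fintype.card_fin] at key
    omega
  · rintro (a | a) ha (b | b) hb hab
    · simp only [Finset.mem_coe, Finset.inl_mem_disjSum, Finset.mem_sdiff, Finset.mem_univ,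
        true_and] at ha hb
      simp only [Sum.elim_inl] at hab
      rw [hf ha hb (Fin.ext (by omega))]
    · simp only [Sum.elim_inl, Sum.elim_inr] at hab
      have := (f a).2
      omega
    · simp only [Sum.elim_inl, Sum.elim_inr] at hab
      have := (f b).2
      omega
    · simp only [Sum.elim_inr] at hab
      rw [show a = b by omega]
  · rintro (a | a) ha (b | b) hb hab
    · simp only [Sum.elim_inl] at hab
      rw [Fin.ext hab]
    · simp only [Finset.mem_coe, Finset.inl_mem_disjSum, Finset.inr_mem_disjSum, Finset.mem_sdiff,
        Finset.mem_univ, true_and, mem_sources] at ha hb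
      simp only [Sum.elim_inl, Sum.elim_inr] at hab
      obtain ⟨hbn, hbJ⟩ := hgJ b hb
      exact absurd ((Fin.ext hab : a = ⟨g b, hbn⟩) ▸ hbJ) ha
    · simp only [Finset.mem_coe, Finset.inl_mem_disjSum, Finset.inr_mem_disjSum, Finset.mem_sdiff,
        Finset.mem_univ, true_and, mem_sources] at ha hb
      simp only [Sum.elim_inl, Sum.elim_inr] at hab
      obtain ⟨han, haJ⟩ := hgJ a ha
      exact absurd ((Fin.ext hab : ⟨g a, han⟩ = b) ▸ haJ) hb
    · simp only [Finset.mem_coe, Finset.inr_mem_disjSum, mem_sources] at ha hb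
      simp only [Sum.elim_inr] at hab
      rw [ha.eq_of_reaches hb (hg a ha) (by rw [hab]; exact hg b hb)]
  · rintro (a | a) ha
    · simp only [Finset.inl_mem_disjSum, Finset.mem_sdiff, Finset.mem_univ, true_and] at ha
      have := (f a).2
      exact ⟨by simp only [Sum.elim_inl, Finset.mem_Icc]; omega, a.2,
        Or.inl ⟨f a, rfl, a.2, (f a).2, hfSA a ha⟩⟩
    · simp only [Finset.inr_mem_disjSum, mem_sources] at ha
      have := ha.1
      exact ⟨by simp only [Sum.elim_inr, Finset.mem_Icc]; omega, (hg a ha).1,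
        Or.inr ⟨a, rfl, ha, hg a ha⟩⟩

/-- A maximum matching of the selection graph yields a minimum selection, whichever of its edges
lead to columns. -/
theorem isMinimumInputSelection_selectedStates {m : ℕ → ℕ} {Y : Finset ℕ}
    (hm : IsMatching n (2 * n) (selectionGraph SA) m)
    (hY : IsCertificate n (2 * n) (selectionGraph SA) m Y) :
    IsMinimumInputSelection SA (identityPattern n) (selectedStates SA m) := by
  refine ⟨structurallyControllable_selectedStates hm, fun J' hJ' => ?_⟩
  have h1 := card_selectedStates_le hm
  have h2 := card_add_card_sources_le hY hJ'
  omega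

end Selection

/-! ### Reasoning about loops -/

namespace Cmd

/-- The variables that a command may change. -/
def varsChanged : Cmd → List ℕ
  | const x _ => [x]
  | addConst x _ _ => [x]
  | addSize x _ => [x]
  | load x _ _ _ => [x]
  | input x _ _ => [x]
  | seq p q => p.varsChanged ++ q.varsChanged
  | ifLt _ _ p q => p.varsChanged ++ q.varsChanged
  | loop x _ _ p => x :: p.varsChanged
  | _ => []

/-- The tags of the matrices that a command may change. -/
def matsChanged : Cmd → List ℕ
  | store t _ _ _ => [t]
  | seq p q => p.matsChanged ++ q.matsChanged
  | ifLt _ _ p q => p.matsChanged ++ q.matsChanged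
  | loop _ _ _ p => p.matsChanged
  | _ => []

theorem eval_v {n : ℕ} (c : Cmd) {s : Store} {y : ℕ} (hy : y ∉ c.varsChanged) :
    (c.eval n s).v y = s.v y := by
  induction c generalizing s with
  | skip => rfl
  | store => rfl
  | const | addConst | addSize | load | input =>
    simp only [varsChanged, List.mem_singleton] at hy
    simp [eval, Store.setV, hy]
  | output => simp only [eval]; split_ifs <;> rfl
  | seq p q ihp ihq =>
    simp only [varsChanged, List.mem_append, not_or] at hy
    rw [eval, ihq hy.2, ihp hy.1]
  | ifLt x z p q ihp ihq =>
    simp only [varsChanged, List.mem_append, not_or] at hy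
    simp only [eval]
    split_ifs
    · exact ihp hy.1
    · exact ihq hy.2
  | loop x a b p ih =>
    simp only [varsChanged, List.mem_cons, not_or] at hy
    simp only [eval]
    generalize a * n + b = N
    induction N with
    | zero => rfl
    | succ N ihN =>
      simp only
      rw [ih hy.2, ← ihN]
      simp [Store.setV, hy.1]

theorem eval_a {n : ℕ} (c : Cmd) {s : Store} {t : ℕ} (ht : t ∉ c.matsChanged) :
    (c.eval n s).a t = s.a t := by
  induction c generalizing s with
  | skip | const | addConst | addSize | load | input => rfl
  | store t' i j x =>
    simp only [matsChanged, List.mem_singleton] at ht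
    simp [eval, Store.setA, ht]
  | output => simp only [eval]; split_ifs <;> rfl
  | seq p q ihp ihq =>
    simp only [matsChanged, List.mem_append, not_or] at ht
    rw [eval, ihq ht.2, ihp ht.1]
  | ifLt x z p q ihp ihq =>
    simp only [matsChanged, List.mem_append, not_or] at ht
    simp only [eval]
    split_ifs
    · exact ihp ht.1
    · exact ihq ht.2
  | loop x a b p ih =>
    simp only [matsChanged] at ht
    simp only [eval]
    generalize a * n + b = N
    induction N with
    | zero => rfl
    | succ N ihN =>
      simp only
      rw [ih ht, ← ihN]
      rfl

/-- Loops are handled by invariants `I k s`, where `k` is the number of rounds completed and `s` the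
store; what the loop cannot change is available in every round. -/
theorem loop_induction {n x a b : ℕ} {p : Cmd} {s : Store} (I : ℕ → Store → Prop) (h0 : I 0 s)
    (hstep : ∀ k < a * n + b, ∀ s', I k s' →
      (∀ y, y ∉ (loop x a b p).varsChanged → s'.v y = s.v y) →
      (∀ t, t ∉ p.matsChanged → s'.a t = s.a t) → I (k + 1) (p.eval n (s'.setV x k))) :
    I (a * n + b) ((loop x a b p).eval n s) := by
  have key : ∀ N ≤ a * n + b, I N (Nat.rec s (fun k s' => p.eval n (s'.setV x k)) N) ∧
      (∀ y, y ∉ (loop x a b p).varsChanged →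
        (Nat.rec s (fun k s' => p.eval n (s'.setV x k)) N : Store).v y = s.v y) ∧
      (∀ t, t ∉ p.matsChanged →
        (Nat.rec s (fun k s' => p.eval n (s'.setV x k)) N : Store).a t = s.a t) := by
    intro N
    induction N with
    | zero => exact fun _ => ⟨h0, fun _ _ => rfl, fun _ _ => rfl⟩
    | succ N ih =>
      intro hN
      obtain ⟨h1, h2, h3⟩ := ih (by omega)
      refine ⟨hstep N (by omega) _ h1 h2 h3, fun y hy => ?_, fun t ht => ?_⟩
      · have hy' := hy
        simp only [varsChanged, List.mem_cons, not_or] at hy'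
        rw [← h2 y hy]
        simp only
        rw [eval_v p hy'.2]
        simp [Store.setV, hy'.1]
      · rw [← h3 t ht]
        exact eval_a p ht
  exact (key _ le_rfl).1

end Cmd

/-! ### The program -/

namespace Cmd

/-!
Variables: `0` holds `0`, `6` holds `1` and `7` holds `n` throughout; `1`, `2`, `3` are loop
variables; `4`, `5`, `8`, `11` hold intermediate values; `9` is a flag; `10` is a row found by a
search; `12` is the left vertex to be matched; `13` counts the states selected.

Matrices, with rows as first index: `0` is reachability, `1` the selection graph; and in column `0`,
`2` marks the sources, `3` holds the matching, `4` marks the rows reached by the search, `5` those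
among them whose partner has been dealt with, `6` holds the parents in the search tree, `7` marks
the left vertices of matched source components and `8` the states selected.
-/

/-- Read the pattern into the matrices of arcs and of the selection graph. -/
def readPattern : Cmd :=
  .loop 1 1 0 <| .seq (.store 0 1 1 6) <| .loop 2 1 0 <| .seq (.input 4 1 2) <|
    .ifLt 0 4 (.seq (.store 0 2 1 6) <| .seq (.addConst 5 2 1) (.store 1 1 5 6)) .skip

/-- One round of Warshall's algorithm, which admits paths through the state in variable `3`. -/
def closeRound : Cmd :=
  .loop 1 1 0 <| .loop 2 1 0 <| .seq (.load 4 0 1 3) <| .seq (.load 5 0 3 2) <|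
    .ifLt 0 4 (.ifLt 0 5 (.store 0 1 2 6) .skip) .skip

/-- Set the flag if the state in variable `3` is a source. -/
def testSource : Cmd :=
  .seq (.const 9 1) <| .loop 1 1 0 <| .seq (.load 4 0 1 3) <| .seq (.load 5 0 3 1) <|
    .ifLt 0 4 (.seq (.ifLt 0 5 .skip (.const 9 0)) (.ifLt 1 3 (.const 9 0) .skip)) .skip

/-- Mark the source in variable `3` and join its left vertex to the states that reach it. -/
def addSource : Cmd :=
  .seq (.store 2 3 0 6) <| .seq (.addSize 8 3) <| .seq (.addConst 8 8 1) <|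
    .loop 1 1 0 <| .seq (.load 4 0 1 3) (.store 1 1 8 4)

/-- Look for a row `r < n + b` with `t[r] > 0` and `u[r] = 0`. -/
def findRow (t u b : ℕ) : Cmd :=
  .seq (.const 9 0) <| .loop 1 1 b <| .seq (.load 4 t 1 0) <| .seq (.load 5 u 1 0) <|
    .ifLt 0 4 (.ifLt 0 5 .skip (.seq (.const 9 1) (.addConst 10 1 0))) .skip

/-- Forget the previous search, and start from the additional row `n`. -/
def initSearch : Cmd :=
  .seq (.loop 1 1 1 (.seq (.store 4 1 0 0) (.store 5 1 0 0))) (.store 4 7 0 6)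

/-- Reach the rows adjacent to the partner of the row in variable `10`. -/
def expandRow : Cmd :=
  .seq (.store 5 10 0 6) <| .seq (.load 11 3 10 0) <| .loop 1 1 0 <| .seq (.load 4 1 1 11) <|
    .seq (.load 5 4 1 0) <|
    .ifLt 0 4 (.ifLt 0 5 .skip (.seq (.store 4 1 0 6) (.store 6 1 0 10))) .skip

/-- The search for alternating paths. -/
def search : Cmd :=
  .seq initSearch <| .loop 2 1 1 <| .seq (findRow 4 5 1) <| .ifLt 0 9 expandRow .skip

/-- Pass partners along the path from the row in variable `10` to the root. -/
def augment : Cmd :=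
  .loop 1 1 1 <| .ifLt 10 7 (.seq (.load 11 6 10 0) <| .seq (.load 4 3 11 0) <|
    .seq (.store 3 10 0 4) (.addConst 10 11 0)) .skip

/-- Match the left vertex in variable `12`, if possible. -/
def matchVertex : Cmd :=
  .seq (.store 3 7 0 12) <| .seq search <| .seq (findRow 4 3 0) <| .ifLt 0 9 augment .skip

/-- Select the rows not matched to columns, and mark the matched source vertices. -/
def selectRows : Cmd :=
  .loop 1 1 0 <| .seq (.load 4 3 1 0) <|
    .ifLt 7 4 (.seq (.store 7 4 0 6) (.store 8 1 0 6)) (.ifLt 0 4 .skip (.store 8 1 0 6))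

/-- Select the sources whose component is left out by the matching. -/
def selectSources : Cmd :=
  .loop 1 1 0 <| .seq (.load 4 2 1 0) <| .seq (.addSize 8 1) <| .seq (.addConst 8 8 1) <|
    .seq (.load 5 7 8 0) <| .ifLt 0 4 (.ifLt 0 5 .skip (.store 8 1 0 6)) .skip

/-- Write and count the selection. -/
def writeSelection : Cmd :=
  .loop 1 1 0 <| .seq (.load 4 8 1 0) <|
    .ifLt 0 4 (.seq (.output 1 6) (.addConst 13 13 1)) (.output 1 0)

/-- The construction of the selection graph. -/
def buildGraph : Cmd :=
  .seq readPattern <| .seq (.loop 3 1 0 closeRound) <|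
    .loop 3 1 0 (.seq testSource (.ifLt 0 9 addSource .skip))

/-- The construction of a maximum matching. -/
def buildMatching : Cmd :=
  .loop 3 2 0 (.seq (.addConst 12 3 1) matchVertex)

/-- The algorithm for minimum input selection. -/
def main : Cmd :=
  .seq (.const 6 1) <| .seq (.addSize 7 0) <| .seq buildGraph <| .seq buildMatching <|
    .seq selectRows <| .seq selectSources writeSelection

theorem cost_main_le (n : ℕ) : main.cost n ≤ 2000 * (n + 1) ^ 3 := by
  simp only [main, buildGraph, buildMatching, readPattern, closeRound, testSource, addSource,
    findRow, initSearch, expandRow, search, augment, matchVertex, selectRows, selectSources,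
    writeSelection, cost]
  ring_nf
  nlinarith [Nat.zero_le n, Nat.zero_le (n ^ 2), Nat.zero_le (n ^ 3)]

end Cmd

/-! ### Correctness of the construction of the selection graph -/

namespace Cmd

/-- The variables `0`, `6` and `7` hold `0`, `1` and `n`, which the program assumes throughout. -/
structure Constants (n : ℕ) (s : Store) : Prop where
  zero : s.v 0 = 0
  one : s.v 6 = 1
  size : s.v 7 = n

theorem Constants.congr {n : ℕ} {s s' : Store} (h : Constants n s) (h0 : s'.v 0 = s.v 0)
    (h1 : s'.v 6 = s.v 6) (h2 : s'.v 7 = s.v 7) : Constants n s' :=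
  ⟨h0.trans h.zero, h1.trans h.one, h2.trans h.size⟩

theorem Constants.eval {n : ℕ} {s : Store} (h : Constants n s) (c : Cmd)
    (h0 : 0 ∉ c.varsChanged := by decide) (h1 : 6 ∉ c.varsChanged := by decide)
    (h2 : 7 ∉ c.varsChanged := by decide) : Constants n (c.eval n s) :=
  h.congr (eval_v c h0) (eval_v c h1) (eval_v c h2)

theorem Constants.setV {n : ℕ} {s : Store} (h : Constants n s) (x k : ℕ)
    (h0 : x ≠ 0 := by decide) (h1 : x ≠ 6 := by decide) (h2 : x ≠ 7 := by decide) :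
    Constants n (s.setV x k) := by
  refine h.congr ?_ ?_ ?_ <;> simp [Store.setV, *, Ne.symm]

variable {n : ℕ} {SA : StructPattern (Fin n) (Fin n)}

theorem eval_readPattern {s : Store} (hs : Constants n s)
    (hin : ∀ i j, i < n → j < n → (0 < s.low (i * n + j) ↔ patternRel SA i j))
    (h0 : ∀ t i j, s.a t i j = 0) :
    (∀ u v, 0 < (readPattern.eval n s).a 0 u v ↔ (u < n ∧ u = v) ∨ patternRel SA v u) ∧
    (∀ r z, 0 < (readPattern.eval n s).a 1 r z ↔ ∃ j, z = j + 1 ∧ patternRel SA r j) := by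
  have hlt : ∀ {i j}, patternRel SA i j → i < n ∧ j < n := fun ⟨hi, hj, _⟩ => ⟨hi, hj⟩
  have key := loop_induction (n := n) (s := s) (x := 1) (a := 1) (b := 0)
    (p := .seq (.store 0 1 1 6) <| .loop 2 1 0 <| .seq (.input 4 1 2) <|
      .ifLt 0 4 (.seq (.store 0 2 1 6) <| .seq (.addConst 5 2 1) (.store 1 1 5 6)) .skip)
    (fun k s' => s'.low = s.low ∧
      (∀ u v, 0 < s'.a 0 u v ↔ (u < k ∧ u = v) ∨ (v < k ∧ patternRel SA v u)) ∧
      (∀ r z, 0 < s'.a 1 r z ↔ r < k ∧ ∃ j, z = j + 1 ∧ patternRel SA r j))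
    (by simp [h0]) ?_
  · refine ⟨fun u v => (key.2.1 u v).trans ?_, fun r z => (key.2.2 r z).trans ?_⟩
    · have := @hlt v u
      grind
    · have := fun j => @hlt r j
      grind
  · rintro k hk s₁ ⟨hl, ha, hb⟩ hv -
    have hs₁ : Constants n s₁ := hs.congr (hv 0 (by decide)) (hv 6 (by decide)) (hv 7 (by decide))
    have inner := loop_induction (n := n) (x := 2) (a := 1) (b := 0)
      (s := (Cmd.store 0 1 1 6).eval n (s₁.setV 1 k))
      (p := .seq (.input 4 1 2) <|
        .ifLt 0 4 (.seq (.store 0 2 1 6) <| .seq (.addConst 5 2 1) (.store 1 1 5 6)) .skip)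
      (fun m s' => s'.low = s.low ∧
        (∀ u v, 0 < s'.a 0 u v ↔ (u < k + 1 ∧ u = v) ∨
          ((v < k ∨ v = k ∧ u < m) ∧ patternRel SA v u)) ∧
        (∀ r z, 0 < s'.a 1 r z ↔ ∃ j, (r < k ∨ r = k ∧ j < m) ∧ z = j + 1 ∧ patternRel SA r j))
      ?_ ?_
    · refine ⟨inner.1, fun u v => (inner.2.1 u v).trans ?_, fun r z => (inner.2.2 r z).trans ?_⟩
      · have := @hlt v u
        grind
      · have := fun j => @hlt r j
        grind
    · refine ⟨hl, fun u v => ?_, fun r z => ?_⟩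
      · have := ha u v
        simp only [Cmd.eval, Store.setA, Store.setV, Function.update_apply]
        grind [hs₁.one]
      · have := hb r z
        simp only [Cmd.eval, Store.setA, Store.setV, Function.update_apply]
        grind
    · rintro m hm s₂ ⟨hl2, ha2, hb2⟩ hv2 -
      have h1 : s₂.v 1 = k := by rw [hv2 1 (by decide)]; simp [Cmd.eval, Store.setA, Store.setV]
      have h6 : s₂.v 6 = 1 := by
        rw [hv2 6 (by decide)]; simp [Cmd.eval, Store.setA, Store.setV, hs₁.one]
      have hz : s₂.v 0 = 0 := by
        rw [hv2 0 (by decide)]; simp [Cmd.eval, Store.setA, Store.setV, hs₁.zero]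
      have hkn : k < n := by omega
      have hmn : m < n := by omega
      have hkm := hin k m hkn hmn
      by_cases hpat : patternRel SA k m
      · have hpos := hkm.2 hpat
        simp [Cmd.eval, Store.setV, Store.setA, h1, h6, hz, hkn, hmn, hl2, hpos]
        constructor
        · intro u v
          have := ha2 u v
          grind
        · intro r z
          have := hb2 r z
          grind
      · have hpos : s.low (k * n + m) = 0 := by
          by_contra h; exact hpat (hkm.1 (by omega))
        simp [Cmd.eval, Store.setV, h1, hz, hkn, hmn, hl2, hpos]
        constructor
        · intro u v
          have := ha2 u v
          grind
        · intro r z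
          have := hb2 r z
          grind

/-- A round of Warshall's algorithm adds exactly the pairs joined through `k`. The entries in row
`k` and column `k`, which it consults, do not change in this round. -/
theorem eval_closeRound {s : Store} (hs : Constants n s) {k : ℕ} (hk : s.v 3 = k) (u v : ℕ) :
    0 < (closeRound.eval n s).a 0 u v ↔
      0 < s.a 0 u v ∨ (u < n ∧ v < n ∧ 0 < s.a 0 u k ∧ 0 < s.a 0 k v) := by
  have key := loop_induction (n := n) (s := s) (x := 1) (a := 1) (b := 0)
    (p := .loop 2 1 0 <| .seq (.load 4 0 1 3) <| .seq (.load 5 0 3 2) <|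
      .ifLt 0 4 (.ifLt 0 5 (.store 0 1 2 6) .skip) .skip)
    (fun i s' => ∀ u v, 0 < s'.a 0 u v ↔
      0 < s.a 0 u v ∨ (u < i ∧ v < n ∧ 0 < s.a 0 u k ∧ 0 < s.a 0 k v))
    (by simp) ?_
  · simp only [one_mul, add_zero] at key
    exact key u v
  · rintro i hi s₁ ha hv -
    have inner := loop_induction (n := n) (x := 2) (a := 1) (b := 0) (s := s₁.setV 1 i)
      (p := .seq (.load 4 0 1 3) <| .seq (.load 5 0 3 2) <|
        .ifLt 0 4 (.ifLt 0 5 (.store 0 1 2 6) .skip) .skip)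
      (fun j s' => ∀ u v, 0 < s'.a 0 u v ↔ 0 < s.a 0 u v ∨
        ((u < i ∧ v < n ∨ u = i ∧ v < j) ∧ 0 < s.a 0 u k ∧ 0 < s.a 0 k v))
      ?_ ?_
    · intro u v
      refine (inner u v).trans ?_
      grind
    · intro u v
      refine (ha u v).trans ?_
      grind
    · rintro j hj s₂ ha2 hv2 -
      have h1 : s₂.v 1 = i := by rw [hv2 1 (by decide)]; simp [Store.setV]
      have h3 : s₂.v 3 = k := by
        rw [hv2 3 (by decide)]; simp [Store.setV, hv 3 (by decide), hk]
      have h6 : s₂.v 6 = 1 := by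
        rw [hv2 6 (by decide)]; simp [Store.setV, hv 6 (by decide), hs.one]
      have hz : s₂.v 0 = 0 := by
        rw [hv2 0 (by decide)]; simp [Store.setV, hv 0 (by decide), hs.zero]
      have hin : i < n := by omega
      have hjn : j < n := by omega
      have hik := ha2 i k
      have hkj := ha2 k j
      intro u v
      have huv := ha2 u v
      simp [Cmd.eval, Store.setV, Store.setA, h1, h3, h6, hz]
      by_cases hA : 0 < s₂.a 0 i k <;> by_cases hB : 0 < s₂.a 0 k j <;> simp [hA, hB] <;> grind

/-- Warshall's algorithm: in round `k` the relation becomes transitive through `k`, and stays so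
through the smaller states. -/
theorem eval_closure {s : Store} (hs : Constants n s)
    (h0 : ∀ u v, 0 < s.a 0 u v ↔ (u < n ∧ u = v) ∨ patternRel SA v u) (u v : ℕ) :
    0 < ((loop 3 1 0 closeRound).eval n s).a 0 u v ↔ Reaches SA u v := by
  have key := loop_induction (n := n) (s := s) (x := 3) (a := 1) (b := 0) (p := closeRound)
    (fun k s' => (∀ u v, 0 < s.a 0 u v → 0 < s'.a 0 u v) ∧
      (∀ u v, 0 < s'.a 0 u v → Reaches SA u v) ∧
      (∀ w < k, ∀ u v, 0 < s'.a 0 u w → 0 < s'.a 0 w v → 0 < s'.a 0 u v)) ?_ ?_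
  · obtain ⟨h1, h2, h3⟩ := key
    refine ⟨h2 u v, ?_⟩
    rintro ⟨hu, h⟩
    induction h with
    | refl => exact h1 _ _ ((h0 _ _).2 (Or.inl ⟨hu, rfl⟩))
    | @tail b c _ hbc ih =>
      have hb : b < n := by obtain ⟨-, hb, -⟩ := hbc; exact hb
      exact h3 b (by omega) _ _ ih (h1 _ _ ((h0 _ _).2 (Or.inr hbc)))
  · refine ⟨fun _ _ h => h, fun u v h => ?_, by simp⟩
    rcases (h0 u v).1 h with ⟨hu, rfl⟩ | h
    · exact Reaches.refl hu
    · exact ⟨by obtain ⟨-, hu, -⟩ := h; exact hu, .single h⟩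
  · rintro k hk s₁ ⟨h1, h2, h3⟩ hv -
    have hs₁ : Constants n s₁ := hs.congr (hv 0 (by decide)) (hv 6 (by decide)) (hv 7 (by decide))
    have hR : ∀ u v, 0 < (closeRound.eval n (s₁.setV 3 k)).a 0 u v ↔
        0 < s₁.a 0 u v ∨ (0 < s₁.a 0 u k ∧ 0 < s₁.a 0 k v) := by
      intro u v
      refine (eval_closeRound (k := k) (hs₁.setV 3 k) (by simp [Store.setV]) u v).trans ?_
      constructor
      · rintro (h | ⟨-, -, h, h'⟩)
        · exact Or.inl h
        · exact Or.inr ⟨h, h'⟩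
      · rintro (h | ⟨h, h'⟩)
        · exact Or.inl h
        · exact Or.inr ⟨(h2 _ _ h).1, (h2 _ _ h').lt_right, h, h'⟩
    refine ⟨fun u v h => (hR u v).2 (Or.inl (h1 u v h)), fun u v h => ?_,
      fun w hw u v hu hv => ?_⟩
    · rcases (hR u v).1 h with h | ⟨h, h'⟩
      · exact h2 _ _ h
      · exact (h2 _ _ h).trans (h2 _ _ h')
    · rw [hR] at hu hv ⊢
      rcases Nat.lt_or_eq_of_le (Nat.le_of_lt_succ hw) with hw | rfl
      · have t1 := h3 w hw u v
        have t2 := h3 w hw u k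
        have t3 := h3 w hw k v
        tauto
      · tauto

theorem eval_testSource {s : Store} (hs : Constants n s) {k : ℕ} (hk : s.v 3 = k) (hkn : k < n)
    (hR : ∀ u v, 0 < s.a 0 u v ↔ Reaches SA u v) :
    0 < (testSource.eval n s).v 9 ↔ IsSource SA k := by
  have key := loop_induction (n := n) (s := s.setV 9 1) (x := 1) (a := 1) (b := 0)
    (p := .seq (.load 4 0 1 3) <| .seq (.load 5 0 3 1) <|
      .ifLt 0 4 (.seq (.ifLt 0 5 .skip (.const 9 0)) (.ifLt 1 3 (.const 9 0) .skip)) .skip)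
    (fun m s' => 0 < s'.v 9 ↔ ∀ u < m, Reaches SA u k → Reaches SA k u ∧ k ≤ u)
    (by simp [Store.setV]) ?_
  · refine key.trans ⟨fun h => ⟨hkn, fun u hu => h u ?_ hu⟩, fun h u _ hu => h.2 u hu⟩
    simpa using hu.1
  · rintro m hm s₁ h hv ha
    have h3 : s₁.v 3 = k := by rw [hv 3 (by decide)]; simp [Store.setV, hk]
    have hz : s₁.v 0 = 0 := by rw [hv 0 (by decide)]; simp [Store.setV, hs.zero]
    have hR' : ∀ u v, 0 < s₁.a 0 u v ↔ Reaches SA u v := by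
      intro u v
      rw [ha 0 (by decide)]
      exact hR u v
    have hsucc : (∀ u < m + 1, Reaches SA u k → Reaches SA k u ∧ k ≤ u) ↔
        0 < s₁.v 9 ∧ (Reaches SA m k → Reaches SA k m ∧ k ≤ m) := by
      rw [h]
      constructor
      · exact fun h => ⟨fun u hu => h u (by omega), h m (by omega)⟩
      · rintro ⟨h, h'⟩ u hu
        rcases Nat.lt_or_eq_of_le (Nat.le_of_lt_succ hu) with hu | rfl
        · exact h u hu
        · exact h'
    rw [hsucc, ← hR', ← hR']
    by_cases hA : 0 < s₁.a 0 m k <;> by_cases hB : 0 < s₁.a 0 k m <;> by_cases hC : m < k <;>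
      simp [Cmd.eval, Store.setV, h3, hz, hA, hB, hC]
    omega

theorem eval_addSource {s : Store} (hs : Constants n s) {k : ℕ} (hk : s.v 3 = k) :
    (∀ i j, (addSource.eval n s).a 2 i j = if i = k ∧ j = 0 then 1 else s.a 2 i j) ∧
    ∀ r z, (addSource.eval n s).a 1 r z =
      if z = n + 1 + k ∧ r < n then s.a 0 r k else s.a 1 r z := by
  have key := loop_induction (n := n)
    (s := (Cmd.addConst 8 8 1).eval n ((Cmd.addSize 8 3).eval n ((Cmd.store 2 3 0 6).eval n s)))
    (x := 1) (a := 1) (b := 0) (p := .seq (.load 4 0 1 3) (.store 1 1 8 4))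
    (fun m s' => ∀ r z, s'.a 1 r z =
      if z = n + 1 + k ∧ r < m then s.a 0 r k else s.a 1 r z)
    (by simp [Cmd.eval, Store.setV, Store.setA]) ?_
  · refine ⟨fun i j => ?_, fun r z => ?_⟩
    · have : (addSource.eval n s).a 2 = ((Cmd.store 2 3 0 6).eval n s).a 2 :=
        eval_a (.seq (.addSize 8 3) <| .seq (.addConst 8 8 1) <|
          .loop 1 1 0 <| .seq (.load 4 0 1 3) (.store 1 1 8 4)) (by decide)
      rw [this]
      simp [Cmd.eval, Store.setA, hk, hs.zero, hs.one]
    · simp only [one_mul, add_zero] at key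
      exact key r z
  · rintro m hm s₁ h hv ha r z
    have h3 : s₁.v 3 = k := by
      rw [hv 3 (by decide)]; simp [Cmd.eval, Store.setA, Store.setV, hk]
    have h8 : s₁.v 8 = n + 1 + k := by
      rw [hv 8 (by decide)]; simp [Cmd.eval, Store.setA, Store.setV, hk]; omega
    have hR : s₁.a 0 = s.a 0 := by
      rw [ha 0 (by decide)]; funext i j; simp [Cmd.eval, Store.setA, Store.setV]
    have := h r z
    simp [Cmd.eval, Store.setV, Store.setA, h3, h8, hR]
    grind

theorem eval_addSources {s : Store} (hs : Constants n s)
    (hR : ∀ u v, 0 < s.a 0 u v ↔ Reaches SA u v)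
    (hG : ∀ r z, 0 < s.a 1 r z ↔ ∃ j, z = j + 1 ∧ patternRel SA r j)
    (h2 : ∀ i j, s.a 2 i j = 0) :
    (∀ v, 0 < ((loop 3 1 0 (.seq testSource (.ifLt 0 9 addSource .skip))).eval n s).a 2 v 0 ↔
      IsSource SA v) ∧
    ∀ r z, 0 < ((loop 3 1 0 (.seq testSource (.ifLt 0 9 addSource .skip))).eval n s).a 1 r z ↔
      selectionGraph SA r z := by
  have key := loop_induction (n := n) (s := s) (x := 3) (a := 1) (b := 0)
    (p := .seq testSource (.ifLt 0 9 addSource .skip))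
    (fun k s' => (∀ v, 0 < s'.a 2 v 0 ↔ v < k ∧ IsSource SA v) ∧
      ∀ r z, 0 < s'.a 1 r z ↔ (∃ j, z = j + 1 ∧ patternRel SA r j) ∨
        ∃ v < k, z = n + 1 + v ∧ IsSource SA v ∧ Reaches SA r v)
    (by simp [h2, hG]) ?_
  · refine ⟨fun v => (key.1 v).trans ⟨fun h => h.2, fun h => ⟨by simpa using h.1, h⟩⟩,
      fun r z => (key.2 r z).trans (or_congr Iff.rfl ?_)⟩
    exact ⟨fun ⟨v, _, h⟩ => ⟨v, h⟩, fun ⟨v, h⟩ => ⟨v, by simpa using h.2.1.1, h⟩⟩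
  · rintro k hk s₁ ⟨ha, hb⟩ hv hfr
    have hs₁ : Constants n s₁ := hs.congr (hv 0 (by decide)) (hv 6 (by decide)) (hv 7 (by decide))
    have hR₁ : ∀ u v, 0 < s₁.a 0 u v ↔ Reaches SA u v := by rw [hfr 0 (by decide)]; exact hR
    have ht := eval_testSource (k := k) (hs₁.setV 3 k) (by simp [Store.setV]) (by omega) hR₁
    set s₂ := testSource.eval n (s₁.setV 3 k) with hs₂
    have ha₂ : ∀ t, s₂.a t = s₁.a t := fun t =>
      eval_a testSource (by simp [testSource, matsChanged])
    have hc₂ : Constants n s₂ := (hs₁.setV 3 k).eval testSource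
    have h3 : s₂.v 3 = k := by
      rw [hs₂, eval_v testSource (by decide)]; simp [Store.setV]
    simp only [Cmd.eval, ← hs₂, hc₂.zero]
    by_cases hsrc : IsSource SA k
    · obtain ⟨e1, e2⟩ := eval_addSource hc₂ h3
      rw [if_pos (ht.2 hsrc)]
      constructor
      · intro v
        rw [e1, ha₂]
        have := ha v
        grind
      · intro r z
        rw [e2, ha₂, ha₂]
        have h4 := hR₁ r k
        have h5 := hb r z
        have h6 : Reaches SA r k → r < n := fun h => h.1
        have hj : ∀ j, patternRel SA r j → j < n := fun j ⟨_, hj, _⟩ => hj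
        by_cases hz : z = n + 1 + k ∧ r < n
        · rw [if_pos hz, h4]
          grind
        · rw [if_neg hz, h5]
          grind
    · rw [if_neg (fun h => hsrc (ht.1 h)), ha₂, ha₂]
      constructor
      · intro v
        rw [ha]
        grind
      · intro r z
        rw [hb]
        grind

theorem eval_buildGraph {s : Store} (hs : Constants n s)
    (hin : ∀ i j, i < n → j < n → (0 < s.low (i * n + j) ↔ patternRel SA i j))
    (h0 : ∀ t i j, s.a t i j = 0) :
    (∀ v, 0 < (buildGraph.eval n s).a 2 v 0 ↔ IsSource SA v) ∧
      ∀ r z, 0 < (buildGraph.eval n s).a 1 r z ↔ selectionGraph SA r z := by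
  obtain ⟨h1, h2⟩ := eval_readPattern hs hin h0
  have hs₁ := hs.eval readPattern
  have hs₂ := hs₁.eval (loop 3 1 0 closeRound)
  refine eval_addSources hs₂ (eval_closure hs₁ h1) (fun r z => ?_) (fun i j => ?_)
  · rw [eval_a _ (by decide)]
    exact h2 r z
  · rw [eval_a _ (by decide), eval_a _ (by decide)]
    exact h0 2 i j

end Cmd

/-! ### Correctness of the construction of a maximum matching -/

namespace Cmd

variable {n : ℕ}

/-- The flag tells whether a row was found; if not, none exists. -/
theorem eval_findRow {s : Store} (hs : Constants n s) (t u b : ℕ) :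
    (0 < ((findRow t u b).eval n s).v 9 → ((findRow t u b).eval n s).v 10 < n + b ∧
      0 < s.a t (((findRow t u b).eval n s).v 10) 0 ∧
      s.a u (((findRow t u b).eval n s).v 10) 0 = 0) ∧
    (((findRow t u b).eval n s).v 9 = 0 → ∀ r < n + b, 0 < s.a t r 0 → 0 < s.a u r 0) := by
  have key := loop_induction (n := n) (s := s.setV 9 0) (x := 1) (a := 1) (b := b)
    (p := .seq (.load 4 t 1 0) <| .seq (.load 5 u 1 0) <|
      .ifLt 0 4 (.ifLt 0 5 .skip (.seq (.const 9 1) (.addConst 10 1 0))) .skip)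
    (fun m s' => (0 < s'.v 9 → s'.v 10 < m ∧ 0 < s.a t (s'.v 10) 0 ∧ s.a u (s'.v 10) 0 = 0) ∧
      (s'.v 9 = 0 → ∀ r < m, 0 < s.a t r 0 → 0 < s.a u r 0))
    (by simp [Store.setV]) ?_
  · simp only [one_mul] at key
    exact key
  · rintro m hm s₁ ⟨h1, h2⟩ hv ha
    have hz : s₁.v 0 = 0 := by rw [hv 0 (by simp [varsChanged])]; simp [Store.setV, hs.zero]
    have ha' : ∀ t, s₁.a t = s.a t := fun t => ha t (by simp [matsChanged])
    by_cases hA : 0 < s.a t m 0 <;> by_cases hB : 0 < s.a u m 0 <;>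
      simp [Cmd.eval, Store.setV, hz, ha', hA, hB] <;> grind

theorem eval_initSearch {s : Store} (hs : Constants n s) {r : ℕ} (hr : r ≤ n) :
    (0 < (initSearch.eval n s).a 4 r 0 ↔ r = n) ∧ (initSearch.eval n s).a 5 r 0 = 0 := by
  have key := loop_induction (n := n) (s := s) (x := 1) (a := 1) (b := 1)
    (p := .seq (.store 4 1 0 0) (.store 5 1 0 0))
    (fun m s' => ∀ r < m, s'.a 4 r 0 = 0 ∧ s'.a 5 r 0 = 0) (by simp) ?_
  · have h1 := key r (by omega)
    have hc := hs.eval (.loop 1 1 1 (.seq (.store 4 1 0 0) (.store 5 1 0 0)))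
    rw [initSearch, Cmd.eval]
    set s₁ := (Cmd.loop 1 1 1 (.seq (.store 4 1 0 0) (.store 5 1 0 0))).eval n s
    simp only [Cmd.eval, Store.setA, hc.zero, hc.one, hc.size]
    grind
  · rintro m hm s₁ h hv - r hr
    have hz : s₁.v 0 = 0 := by rw [hv 0 (by decide)]; exact hs.zero
    have := h r
    simp [Cmd.eval, Store.setV, Store.setA, hz]
    grind

theorem eval_expandRow {s : Store} (hs : Constants n s) (r : ℕ) :
    (0 < (expandRow.eval n s).a 5 r 0 ↔ 0 < s.a 5 r 0 ∨ r = s.v 10) ∧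
    (0 < (expandRow.eval n s).a 4 r 0 ↔
      0 < s.a 4 r 0 ∨ (r < n ∧ 0 < s.a 1 r (s.a 3 (s.v 10) 0))) ∧
    ((expandRow.eval n s).a 6 r 0 =
      if r < n ∧ 0 < s.a 1 r (s.a 3 (s.v 10) 0) ∧ s.a 4 r 0 = 0 then s.v 10
      else s.a 6 r 0) := by
  have key := loop_induction (n := n)
    (s := (Cmd.load 11 3 10 0).eval n ((Cmd.store 5 10 0 6).eval n s)) (x := 1) (a := 1) (b := 0)
    (p := .seq (.load 4 1 1 11) <| .seq (.load 5 4 1 0) <|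
      .ifLt 0 4 (.ifLt 0 5 .skip (.seq (.store 4 1 0 6) (.store 6 1 0 10))) .skip)
    (fun m s' => ∀ r, (0 < s'.a 4 r 0 ↔
      0 < s.a 4 r 0 ∨ (r < m ∧ 0 < s.a 1 r (s.a 3 (s.v 10) 0))) ∧
      (s'.a 6 r 0 = if r < m ∧ 0 < s.a 1 r (s.a 3 (s.v 10) 0) ∧ s.a 4 r 0 = 0 then s.v 10
        else s.a 6 r 0))
    (by simp [Cmd.eval, Store.setV, Store.setA]) ?_
  · simp only [one_mul, add_zero] at key
    refine ⟨?_, key r⟩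
    have : (expandRow.eval n s).a 5 = ((Cmd.store 5 10 0 6).eval n s).a 5 :=
      eval_a (.seq (.load 11 3 10 0) <| .loop 1 1 0 <| .seq (.load 4 1 1 11) <|
        .seq (.load 5 4 1 0) <|
        .ifLt 0 4 (.ifLt 0 5 .skip (.seq (.store 4 1 0 6) (.store 6 1 0 10))) .skip) (by decide)
    rw [this]
    simp only [Cmd.eval, Store.setA, hs.zero, hs.one]
    grind
  · rintro m hm s₁ h hv ha r
    have hz : s₁.v 0 = 0 := by
      rw [hv 0 (by decide)]; simp [Cmd.eval, Store.setA, Store.setV, hs.zero]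
    have h6 : s₁.v 6 = 1 := by
      rw [hv 6 (by decide)]; simp [Cmd.eval, Store.setA, Store.setV, hs.one]
    have h10 : s₁.v 10 = s.v 10 := by
      rw [hv 10 (by decide)]; simp [Cmd.eval, Store.setA, Store.setV]
    have h11 : s₁.v 11 = s.a 3 (s.v 10) 0 := by
      rw [hv 11 (by decide)]; simp [Cmd.eval, Store.setA, Store.setV, hs.zero]
    have hG : s₁.a 1 = s.a 1 := by
      rw [ha 1 (by decide)]; funext i j; simp [Cmd.eval, Store.setA, Store.setV]
    have hr := h r
    have hm' := h m
    by_cases hA : 0 < s.a 1 m (s.a 3 (s.v 10) 0) <;> by_cases hB : 0 < s₁.a 4 m 0 <;>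
      simp [Cmd.eval, Store.setV, Store.setA, hz, h6, h10, h11, hG, hA, hB] <;> grind

/-- The rows reached by the search. -/
def Reached (n : ℕ) (s : Store) (r : ℕ) : Prop := r ≤ n ∧ 0 < s.a 4 r 0

/-- The search reaches a tree of rows of bounded depth that cannot be enlarged. Every round deals
with one more row, or has none left. -/
theorem eval_search {s : Store} (hs : Constants n s) {G : ℕ → ℕ → Prop} {m : ℕ → ℕ}
    (hG : ∀ r z, 0 < s.a 1 r z ↔ G r z) (hm : ∀ r, s.a 3 r 0 = m r) :
    ∃ d : ℕ → ℕ, IsSearchTree n G m (Reached n (search.eval n s))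
        (fun r => (search.eval n s).a 6 r 0) d ∧
      SearchClosed n G m (Reached n (search.eval n s)) ∧
      ∀ r, Reached n (search.eval n s) r → d r ≤ n + 1 := by
  have hc := hs.eval initSearch
  have key := loop_induction (n := n) (s := initSearch.eval n s) (x := 2) (a := 1) (b := 1)
    (p := .seq (findRow 4 5 1) <| .ifLt 0 9 expandRow .skip)
    (fun t s' => ∃ d : ℕ → ℕ, IsSearchTree n G m (Reached n s') (fun r => s'.a 6 r 0) d ∧
      (∀ r, Reached n s' r → d r ≤ t) ∧
      (∀ p ≤ n, 0 < s'.a 5 p 0 → Reached n s' p ∧ ∀ r < n, G r (m p) → Reached n s' r) ∧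
      (t ≤ ((Finset.range (n + 1)).filter fun p => 0 < s'.a 5 p 0).card ∨
        ∀ r, Reached n s' r → 0 < s'.a 5 r 0)) ?_ ?_
  · obtain ⟨d, h1, h2, h3, h4⟩ := key
    refine ⟨d, h1, fun p hp r hr hGr => ?_, fun r hr => ?_⟩
    · refine (h3 p hp.1 ?_).2 r hr hGr
      rcases h4 with h4 | h4
      · have hfull : ((Finset.range (n + 1)).filter fun p => 0 < (search.eval n s).a 5 p 0) =
            Finset.range (n + 1) :=
          Finset.eq_of_subset_of_card_le (Finset.filter_subset _ _) (by
            rw [Finset.card_range]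
            rw [one_mul] at h4
            exact h4)
        have hp' : p ∈ Finset.range (n + 1) := Finset.mem_range.2 (Nat.lt_succ_of_le hp.1)
        rw [← hfull] at hp'
        exact (Finset.mem_filter.1 hp').2
      · exact h4 p hp
    · have := h2 r hr
      rw [one_mul] at this
      exact this
  · have hvis : ∀ r, Reached n (initSearch.eval n s) r ↔ r = n := by
      intro r
      constructor
      · exact fun h => (eval_initSearch hs h.1).1.1 h.2
      · rintro rfl
        exact ⟨le_rfl, (eval_initSearch hs le_rfl).1.2 rfl⟩
    refine ⟨fun _ => 0, ⟨(hvis n).2 rfl, fun r h => h.1, fun r h1 h2 => absurd ((hvis r).1 h1) h2⟩,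
      fun _ _ => le_rfl, fun p hp h => ?_, Or.inl (Nat.zero_le _)⟩
    rw [(eval_initSearch hs hp).2] at h
    exact absurd h (lt_irrefl _)
  · rintro t ht s₁ ⟨d, h1, h2, h3, h4⟩ hv ha
    have hs₁ : Constants n s₁ :=
      hc.congr (hv 0 (by decide)) (hv 6 (by decide)) (hv 7 (by decide))
    have hs₂ : Constants n (s₁.setV 2 t) := hs₁.setV 2 t
    obtain ⟨hf1, hf2⟩ := eval_findRow hs₂ 4 5 1
    set s₃ := (findRow 4 5 1).eval n (s₁.setV 2 t) with hs₃
    have hc₃ : Constants n s₃ := hs₂.eval _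
    have ha₃ : ∀ t, s₃.a t = s₁.a t := fun t =>
      eval_a (findRow 4 5 1) (by simp [findRow, matsChanged])
    have hG₃ : ∀ r z, 0 < s₃.a 1 r z ↔ G r z := by
      rw [ha₃, ha 1 (by decide), eval_a initSearch (by decide)]; exact hG
    have hm₃ : ∀ r, s₃.a 3 r 0 = m r := by
      rw [ha₃, ha 3 (by decide), eval_a initSearch (by decide)]; exact hm
    change (0 < s₃.v 9 → s₃.v 10 < n + 1 ∧ 0 < s₁.a 4 (s₃.v 10) 0 ∧ s₁.a 5 (s₃.v 10) 0 = 0) at hf1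
    change (s₃.v 9 = 0 → ∀ r < n + 1, 0 < s₁.a 4 r 0 → 0 < s₁.a 5 r 0) at hf2
    simp only [Cmd.eval, ← hs₃, hc₃.zero]
    by_cases hflag : 0 < s₃.v 9
    · rw [if_pos hflag]
      obtain ⟨hq, hq4, hq5⟩ := hf1 hflag
      have hE := eval_expandRow hc₃
      set s₄ := expandRow.eval n s₃
      set q := s₃.v 10
      simp only [hm₃, hG₃] at hE
      simp only [ha₃] at hE
      have hqr : Reached n s₁ q := ⟨by omega, hq4⟩
      have hvis : ∀ r, Reached n s₄ r ↔ Reached n s₁ r ∨ (r < n ∧ G r (m q)) := by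
        intro r
        have := (hE r).2.1
        unfold Reached
        grind
      have hpar : ∀ r, Reached n s₁ r → s₄.a 6 r 0 = s₁.a 6 r 0 := by
        intro r hr
        rw [(hE r).2.2, if_neg]
        rintro ⟨-, -, h⟩
        exact hr.2.ne' h
      have hpar' : ∀ r, ¬ Reached n s₁ r → r < n → G r (m q) → s₄.a 6 r 0 = q := by
        intro r hr hrn hGr
        have hGr' := (hG₃ r (m q)).2 hGr
        rw [← hm₃, ha₃, ha₃] at hGr'
        rw [(hE r).2.2, if_pos]
        refine ⟨hrn, hGr', ?_⟩
        by_contra h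
        exact hr ⟨hrn.le, by omega⟩
      classical
      refine ⟨fun r => if Reached n s₁ r then d r else t + 1,
        ⟨(hvis n).2 (Or.inl h1.root), fun r h => h.1, fun r hr hrn => ?_⟩, fun r hr => ?_,
        fun p hp hp5 => ?_, ?_⟩
      · by_cases hr1 : Reached n s₁ r
        · obtain ⟨e1, e2, e3⟩ := h1.parent r hr1 hrn
          simp only [hpar r hr1, if_pos hr1, if_pos e1]
          exact ⟨(hvis _).2 (Or.inl e1), e2, e3⟩
        · obtain ⟨hrn, hGr⟩ := ((hvis r).1 hr).resolve_left hr1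
          simp only [hpar' r hr1 hrn hGr, if_neg hr1, if_pos hqr]
          exact ⟨(hvis _).2 (Or.inl hqr), Nat.lt_succ_of_le (h2 q hqr), hGr⟩
      · simp only
        split_ifs with hr1
        · exact (h2 r hr1).trans (Nat.le_succ t)
        · exact le_rfl
      · rcases (hE p).1.1 hp5 with hp5 | rfl
        · obtain ⟨e1, e2⟩ := h3 p hp hp5
          exact ⟨(hvis _).2 (Or.inl e1), fun r hr hGr => (hvis _).2 (Or.inl (e2 r hr hGr))⟩
        · exact ⟨(hvis _).2 (Or.inl hqr), fun r hr hGr => (hvis _).2 (Or.inr ⟨hr, hGr⟩)⟩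
      · left
        have hle : t ≤ ((Finset.range (n + 1)).filter fun p => 0 < s₁.a 5 p 0).card := by
          refine h4.resolve_right fun h => ?_
          exact absurd (h q hqr) (by omega)
        have hins : insert q ((Finset.range (n + 1)).filter fun p => 0 < s₁.a 5 p 0) ⊆
            (Finset.range (n + 1)).filter fun p => 0 < s₄.a 5 p 0 := by
          intro p hp
          rw [Finset.mem_filter, (hE p).1]
          rcases Finset.mem_insert.1 hp with rfl | hp
          · exact ⟨Finset.mem_range.2 hq, Or.inr rfl⟩
          · exact ⟨(Finset.mem_filter.1 hp).1, Or.inl (Finset.mem_filter.1 hp).2⟩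
        have := Finset.card_le_card hins
        rw [Finset.card_insert_of_notMem (by simp [hq5])] at this
        omega
    · rw [if_neg hflag]
      have hR : Reached n s₃ = Reached n s₁ := by unfold Reached; rw [ha₃]
      have hall := hf2 (by omega)
      simp only [hR, ha₃]
      exact ⟨d, h1, fun r hr => (h2 r hr).trans (Nat.le_succ t), h3,
        Or.inr fun r hr => hall r (by have := hr.1; omega) hr.2⟩

/-- The walk from a free row along the parents ends at the root, since the depth decreases. -/
theorem eval_augment {s : Store} (hs : Constants n s) {k c : ℕ} {G : ℕ → ℕ → Prop}
    (hG : ∀ r, ¬ G r 0) {vis : ℕ → Prop} (hvis : ∀ r, vis r → r ≤ n) {d : ℕ → ℕ}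
    (hd : ∀ r, vis r → d r ≤ n + 1)
    (h : IsAugmenting n k c G vis (fun r => s.a 6 r 0) d (fun r => s.a 3 r 0) (s.v 10)) :
    IsMatching n k G (fun r => (augment.eval n s).a 3 r 0) ∧
      (matchedRows n fun r => (augment.eval n s).a 3 r 0).card = c := by
  have key := loop_induction (n := n) (s := s) (x := 1) (a := 1) (b := 1)
    (p := .ifLt 10 7 (.seq (.load 11 6 10 0) <| .seq (.load 4 3 11 0) <|
      .seq (.store 3 10 0 4) (.addConst 10 11 0)) .skip)
    (fun t s' => IsAugmenting n k c G vis (fun r => s.a 6 r 0) d (fun r => s'.a 3 r 0) (s'.v 10) ∧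
      (s'.v 10 = n ∨ d (s'.v 10) + t ≤ n + 1)) ⟨h, Or.inr (hd _ h.mem)⟩ ?_
  · obtain ⟨h1, h2⟩ := key
    rw [one_mul] at h2
    have hq : ((loop 1 1 1 (.ifLt 10 7 (.seq (.load 11 6 10 0) <| .seq (.load 4 3 11 0) <|
      .seq (.store 3 10 0 4) (.addConst 10 11 0)) .skip)).eval n s).v 10 = n := by
      by_contra hne
      have := (h1.parent _ h1.mem hne le_rfl).2.1
      omega
    rw [hq] at h1
    exact h1.isMatching
  · rintro t ht s₁ ⟨h1, h2⟩ hv ha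
    have hs₁ : Constants n s₁ := hs.congr (hv 0 (by decide)) (hv 6 (by decide)) (hv 7 (by decide))
    have h6 : s₁.a 6 = s.a 6 := ha 6 (by decide)
    have hqn := hvis _ h1.mem
    by_cases hq : s₁.v 10 = n
    · simp [Cmd.eval, Store.setV, hs₁.size, hq]
      rwa [hq] at h1
    · have hlt : s₁.v 10 < n := by omega
      have hstep := h1.step hvis hq hG
      have hdec := (h1.parent _ h1.mem hq le_rfl).2.1
      simp [Cmd.eval, Store.setV, Store.setA, hs₁.size, hs₁.zero, hlt, h6]
      constructor
      · convert hstep using 1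
        funext r
        simp only [Function.update_apply]
      · right
        omega

/-- Whether or not the search reaches a free row, a matching with a certificate is kept. -/
theorem eval_matchVertex {s : Store} (hs : Constants n s) {k : ℕ} (hk : s.v 12 = k + 1)
    {G : ℕ → ℕ → Prop} (hG0 : ∀ r, ¬ G r 0) (hG : ∀ r z, 0 < s.a 1 r z ↔ G r z)
    (hm : IsMatching n k G fun r => s.a 3 r 0) {Y : Finset ℕ}
    (hY : IsCertificate n k G (fun r => s.a 3 r 0) Y) :
    IsMatching n (k + 1) G (fun r => (matchVertex.eval n s).a 3 r 0) ∧
      ∃ Y', IsCertificate n (k + 1) G (fun r => (matchVertex.eval n s).a 3 r 0) Y' := by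
  set s₁ := (Cmd.store 3 7 0 12).eval n s with hs₁
  have hc₁ : Constants n s₁ := hs.eval (.store 3 7 0 12)
  have hm₁ : ∀ r < n, s₁.a 3 r 0 = s.a 3 r 0 := by
    intro r hr
    simp [hs₁, Cmd.eval, Store.setA, hs.size, hr.ne]
  have hn₁ : s₁.a 3 n 0 = k + 1 := by
    simp [hs₁, Cmd.eval, Store.setA, hs.size, hs.zero, hk]
  have hG₁ : ∀ r z, 0 < s₁.a 1 r z ↔ G r z := by
    rw [hs₁, eval_a _ (by decide)]; exact hG
  have hM : IsMatching n k G fun r => s₁.a 3 r 0 := hm.congr hm₁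
  have hY₁ : IsCertificate n k G (fun r => s₁.a 3 r 0) Y := by
    refine ⟨hY.1, ?_⟩
    rw [matchedRows_congr hm₁]
    exact hY.2
  obtain ⟨d, hT, hcl, hd⟩ := eval_search hc₁ hG₁ (fun r => rfl)
  set s₂ := search.eval n s₁ with hs₂
  have hc₂ : Constants n s₂ := hc₁.eval search
  have hm₂ : s₂.a 3 = s₁.a 3 := eval_a search (by decide)
  obtain ⟨hf1, hf2⟩ := eval_findRow hc₂ 4 3 0
  set s₃ := (findRow 4 3 0).eval n s₂ with hs₃
  have hc₃ : Constants n s₃ := hc₂.eval _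
  have ha₃ : ∀ t, s₃.a t = s₂.a t := fun t =>
    eval_a (findRow 4 3 0) (by simp [findRow, matsChanged])
  have hfin : matchVertex.eval n s = if s₃.v 0 < s₃.v 9 then augment.eval n s₃ else s₃ := rfl
  rw [hfin, hc₃.zero]
  rw [hm₂] at hf1 hf2
  by_cases hflag : 0 < s₃.v 9
  · rw [if_pos hflag]
    obtain ⟨hq, hq4, hq3⟩ := hf1 hflag
    have haug := eval_augment hc₃ (k := k + 1)
      (c := (matchedRows n fun r => s₁.a 3 r 0).card + 1) hG0 hT.le hd (by
        simp only [ha₃, hm₂]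
        exact hT.isAugmenting hM hn₁ ⟨by omega, hq4⟩ (by omega) hq3)
    exact ⟨haug.1, Y, hY₁.extend_of_augmented haug.2⟩
  · rw [if_neg hflag]
    simp only [ha₃, hm₂]
    refine ⟨⟨fun r hr => (hM.le r hr).trans (Nat.le_succ k), hM.edge, hM.inj⟩, ?_⟩
    refine hY₁.extend_of_search_failed hM hn₁ hT hcl fun r hr hvr => ?_
    exact (hf2 (by omega) r (by omega) hvr.2).ne'

theorem eval_buildMatching {s : Store} (hs : Constants n s) {G : ℕ → ℕ → Prop}
    (hG0 : ∀ r, ¬ G r 0) (hG : ∀ r z, 0 < s.a 1 r z ↔ G r z) (h3 : ∀ i j, s.a 3 i j = 0) :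
    IsMatching n (2 * n) G (fun r => (buildMatching.eval n s).a 3 r 0) ∧
      ∃ Y, IsCertificate n (2 * n) G (fun r => (buildMatching.eval n s).a 3 r 0) Y := by
  refine loop_induction (n := n) (s := s) (x := 3) (a := 2) (b := 0)
    (p := .seq (.addConst 12 3 1) matchVertex)
    (fun k s' => IsMatching n k G (fun r => s'.a 3 r 0) ∧
      ∃ Y, IsCertificate n k G (fun r => s'.a 3 r 0) Y) ?_ ?_
  · refine ⟨⟨fun r _ => by simp [h3], fun r _ h => absurd (h3 r 0) h,
      fun r _ r' _ h => absurd (h3 r 0) h⟩, ∅, by simp, ?_⟩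
    simp [rowNeighbors]
  · rintro k hk s₁ ⟨h1, Y, hY⟩ hv ha
    have hs₁ : Constants n s₁ := hs.congr (hv 0 (by decide)) (hv 6 (by decide)) (hv 7 (by decide))
    have hs₂ := (hs₁.setV 3 k).eval (.addConst 12 3 1)
    refine eval_matchVertex hs₂ (by simp [Cmd.eval, Store.setV]) hG0 ?_ h1 hY
    change ∀ r z, 0 < s₁.a 1 r z ↔ G r z
    rw [ha 1 (by decide)]
    exact hG

/-! ### Correctness of the selection -/

theorem eval_selectRows {s : Store} (hs : Constants n s) (h7 : ∀ i j, s.a 7 i j = 0)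
    (h8 : ∀ i j, s.a 8 i j = 0) :
    (∀ i, 0 < (selectRows.eval n s).a 8 i 0 ↔ i < n ∧ (s.a 3 i 0 = 0 ∨ n < s.a 3 i 0)) ∧
    ∀ z, 0 < (selectRows.eval n s).a 7 z 0 ↔ n < z ∧ ∃ r < n, s.a 3 r 0 = z := by
  have key := loop_induction (n := n) (s := s) (x := 1) (a := 1) (b := 0)
    (p := .seq (.load 4 3 1 0) <|
      .ifLt 7 4 (.seq (.store 7 4 0 6) (.store 8 1 0 6)) (.ifLt 0 4 .skip (.store 8 1 0 6)))
    (fun k s' => (∀ i, 0 < s'.a 8 i 0 ↔ i < k ∧ (s.a 3 i 0 = 0 ∨ n < s.a 3 i 0)) ∧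
      ∀ z, 0 < s'.a 7 z 0 ↔ n < z ∧ ∃ r < k, s.a 3 r 0 = z) (by simp [h7, h8]) ?_
  · simp only [one_mul, add_zero] at key
    exact key
  · rintro k hk s₁ ⟨h1, h2⟩ hv ha
    have hs₁ : Constants n s₁ := hs.congr (hv 0 (by decide)) (hv 6 (by decide)) (hv 7 (by decide))
    have hm : s₁.a 3 = s.a 3 := ha 3 (by decide)
    have hsucc : ∀ z, (∃ r < k + 1, s.a 3 r 0 = z) ↔ (∃ r < k, s.a 3 r 0 = z) ∨ s.a 3 k 0 = z := by
      intro z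
      constructor
      · rintro ⟨r, hr, h⟩
        rcases Nat.lt_or_eq_of_le (Nat.le_of_lt_succ hr) with hr | rfl
        · exact Or.inl ⟨r, hr, h⟩
        · exact Or.inr h
      · rintro (⟨r, hr, h⟩ | h)
        · exact ⟨r, by omega, h⟩
        · exact ⟨k, by omega, h⟩
    simp only [hsucc]
    by_cases hA : n < s.a 3 k 0
    · simp [Cmd.eval, Store.setV, Store.setA, hs₁.zero, hs₁.one, hs₁.size, hm, hA]
      constructor
      · intro i
        have := h1 i
        grind
      · intro z
        have := h2 z
        grind
    · by_cases hB : 0 < s.a 3 k 0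
      · simp [Cmd.eval, Store.setV, hs₁.zero, hs₁.size, hm, hA, hB]
        constructor
        · intro i
          have := h1 i
          grind
        · intro z
          have := h2 z
          grind
      · simp [Cmd.eval, Store.setV, Store.setA, hs₁.zero, hs₁.one, hs₁.size, hm, hA, hB]
        constructor
        · intro i
          have := h1 i
          grind
        · intro z
          have := h2 z
          grind

theorem eval_selectSources {s : Store} (hs : Constants n s) (i : ℕ) :
    0 < (selectSources.eval n s).a 8 i 0 ↔
      0 < s.a 8 i 0 ∨ (i < n ∧ 0 < s.a 2 i 0 ∧ s.a 7 (n + 1 + i) 0 = 0) := by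
  have key := loop_induction (n := n) (s := s) (x := 1) (a := 1) (b := 0)
    (p := .seq (.load 4 2 1 0) <| .seq (.addSize 8 1) <| .seq (.addConst 8 8 1) <|
      .seq (.load 5 7 8 0) <| .ifLt 0 4 (.ifLt 0 5 .skip (.store 8 1 0 6)) .skip)
    (fun k s' => ∀ i, 0 < s'.a 8 i 0 ↔
      0 < s.a 8 i 0 ∨ (i < k ∧ 0 < s.a 2 i 0 ∧ s.a 7 (n + 1 + i) 0 = 0)) (by simp) ?_
  · simp only [one_mul, add_zero] at key
    exact key i
  · rintro k hk s₁ h hv ha i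
    have hs₁ : Constants n s₁ := hs.congr (hv 0 (by decide)) (hv 6 (by decide)) (hv 7 (by decide))
    have h2 : s₁.a 2 = s.a 2 := ha 2 (by decide)
    have h7 : s₁.a 7 = s.a 7 := ha 7 (by decide)
    have hi := h i
    have hadd : k + n + 1 = n + 1 + k := by omega
    by_cases hA : 0 < s.a 2 k 0 <;> by_cases hB : 0 < s.a 7 (n + 1 + k) 0 <;>
      simp [Cmd.eval, Store.setV, Store.setA, hs₁.zero, hs₁.one, h2, h7, hadd, hA, hB] <;> grind

theorem eval_writeSelection {s : Store} (hs : Constants n s) (h13 : s.v 13 = 0) :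
    (∀ j < n, (writeSelection.eval n s).low j = if 0 < s.a 8 j 0 then 1 else 0) ∧
      (writeSelection.eval n s).v 13 = ((Finset.range n).filter fun j => 0 < s.a 8 j 0).card := by
  have key := loop_induction (n := n) (s := s) (x := 1) (a := 1) (b := 0)
    (p := .seq (.load 4 8 1 0) <|
      .ifLt 0 4 (.seq (.output 1 6) (.addConst 13 13 1)) (.output 1 0))
    (fun k s' => (∀ j < k, s'.low j = if 0 < s.a 8 j 0 then 1 else 0) ∧
      s'.v 13 = ((Finset.range k).filter fun j => 0 < s.a 8 j 0).card) (by simp [h13]) ?_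
  · simp only [one_mul, add_zero] at key
    exact key
  · rintro k hk s₁ ⟨h1, h2⟩ hv ha
    have hs₁ : Constants n s₁ := hs.congr (hv 0 (by decide)) (hv 6 (by decide)) (hv 7 (by decide))
    have h8 : s₁.a 8 = s.a 8 := ha 8 (by decide)
    have hkn : k < n := by omega
    rw [Finset.range_add_one, Finset.filter_insert]
    by_cases hA : 0 < s.a 8 k 0
    · simp [Cmd.eval, Store.setV, hs₁.zero, hs₁.one, h8, hA, hkn, h2, Function.update_apply]
      intro j hj
      have := h1 j
      grind
    · simp [Cmd.eval, Store.setV, hs₁.zero, h8, hA, hkn, h2, Function.update_apply]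
      intro j hj
      have := h1 j
      grind

/-- The output of the algorithm solves the selection problem. -/
theorem eval_main {SA : StructPattern (Fin n) (Fin n)} {s : Store}
    (hin : ∀ i j, i < n → j < n → (0 < s.low (i * n + j) ↔ patternRel SA i j))
    (hv : ∀ x, s.v x = 0) (h0 : ∀ t i j, s.a t i j = 0) :
    ∃ J : Finset (Fin n), IsMinimumInputSelection SA (identityPattern n) J ∧
      (∀ j : Fin n, (main.eval n s).low j = if j ∈ J then 1 else 0) ∧
      (main.eval n s).v 13 = J.card ∧ (main.eval n s).v 0 = 0 := by
  set s₁ := (Cmd.addSize 7 0).eval n ((Cmd.const 6 1).eval n s) with hs₁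
  have hc₁ : Constants n s₁ := by
    constructor <;> simp [hs₁, Cmd.eval, Store.setV, hv]
  obtain ⟨hsrc, hG⟩ := eval_buildGraph (SA := SA) hc₁ (s := s₁) hin h0
  set s₂ := buildGraph.eval n s₁ with hs₂
  have hc₂ : Constants n s₂ := hc₁.eval buildGraph
  have hG0 : ∀ r, ¬ selectionGraph SA r 0 := by
    rintro r (⟨j, hj, -⟩ | ⟨v, hv, -⟩) <;> omega
  have h0₂ : ∀ t ∉ buildGraph.matsChanged, ∀ i j, s₂.a t i j = 0 := by
    intro t ht
    rw [hs₂, eval_a buildGraph ht]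
    exact h0 t
  obtain ⟨hM, Y, hY⟩ := eval_buildMatching hc₂ hG0 hG (h0₂ 3 (by decide))
  set s₃ := buildMatching.eval n s₂ with hs₃
  have hc₃ : Constants n s₃ := hc₂.eval buildMatching
  have h0₃ : ∀ t ∉ buildGraph.matsChanged, t ∉ buildMatching.matsChanged →
      ∀ i j, s₃.a t i j = 0 := by
    intro t ht ht'
    rw [hs₃, eval_a buildMatching ht']
    exact h0₂ t ht
  obtain ⟨h8, h7⟩ := eval_selectRows hc₃ (h0₃ 7 (by decide) (by decide))
    (h0₃ 8 (by decide) (by decide))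
  set s₄ := selectRows.eval n s₃ with hs₄
  have hc₄ : Constants n s₄ := hc₃.eval selectRows
  have h2₄ : ∀ v, 0 < s₄.a 2 v 0 ↔ IsSource SA v := by
    rw [hs₄, eval_a selectRows (by decide), hs₃, eval_a buildMatching (by decide)]
    exact hsrc
  have h8' := eval_selectSources hc₄
  set s₅ := selectSources.eval n s₄ with hs₅
  have hc₅ : Constants n s₅ := hc₄.eval selectSources
  have h13 : s₅.v 13 = 0 := by
    rw [hs₅, eval_v selectSources (by decide), hs₄, eval_v selectRows (by decide), hs₃,
      eval_v buildMatching (by decide), hs₂, eval_v buildGraph (by decide)]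
    simp [hs₁, Cmd.eval, Store.setV, hv]
  obtain ⟨hlow, hcount⟩ := eval_writeSelection hc₅ h13
  have hfin : main.eval n s = writeSelection.eval n s₅ := rfl
  have hmem : ∀ j : Fin n, 0 < s₅.a 8 j 0 ↔ j ∈ selectedStates SA fun r => s₃.a 3 r 0 := by
    intro j
    rw [h8' j, h8 j, h2₄ j]
    have h7j : s₄.a 7 (n + 1 + j) 0 = 0 ↔ ∀ r < n, s₃.a 3 r 0 ≠ n + 1 + j := by
      have := h7 (n + 1 + j)
      constructor
      · intro h r hr he
        have := this.2 ⟨by omega, r, hr, he⟩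
        omega
      · intro h
        by_contra h'
        obtain ⟨-, r, hr, he⟩ := this.1 (by omega)
        exact h r hr he
    simp only [h7j, selectedStates, Finset.mem_filter, Finset.mem_univ, true_and, j.2, or_assoc]
  refine ⟨_, isMinimumInputSelection_selectedStates hM hY, fun j => ?_, ?_, ?_⟩
  · rw [hfin, hlow j j.2]
    exact if_congr (hmem j) rfl rfl
  · rw [hfin, hcount, ← Finset.card_map Fin.valEmbedding]
    congr 1
    ext r
    simp only [Finset.mem_filter, Finset.mem_range, Finset.mem_map, Fin.valEmbedding_apply]
    constructor
    · rintro ⟨hr, h⟩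
      exact ⟨⟨r, hr⟩, (hmem ⟨r, hr⟩).1 h, rfl⟩
    · rintro ⟨j, hj, rfl⟩
      exact ⟨j.2, (hmem j).2 hj⟩
  · rw [hfin]
    exact (hc₅.eval writeSelection).zero

end Cmd

/-! ### Input, output and the size of words -/

theorem wordBound_mono {b b' : ℕ} (h : b ≤ b') : wordBound b ≤ wordBound b' :=
  Nat.add_le_add (Nat.mul_le_mul h h) (polyPair_mono (polyPair_mono h h) h)

theorem wordBound_le (b : ℕ) : wordBound b ≤ 38 * b ^ 4 := by
  have h1 : b ≤ b * b := Nat.le_mul_self b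
  have h2 : polyPair b b ≤ 5 * (b * b) := by unfold polyPair; nlinarith
  have h3 : b * b ≤ (b * b) * (b * b) := Nat.le_mul_self _
  have h4 := polyPair_mono h2 h1
  have h5 : polyPair (5 * (b * b)) (b * b) = 36 * ((b * b) * (b * b)) + b * b := by
    unfold polyPair; ring
  have h6 : polyPair (polyPair b b) b ≤ 36 * ((b * b) * (b * b)) + b * b := h5 ▸ h4
  unfold wordBound
  calc b * b + polyPair (polyPair b b) b ≤ 38 * ((b * b) * (b * b)) := by omega
    _ = 38 * b ^ 4 := by ring

/-- The store that the input state of the machine represents. -/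
noncomputable def initialStore {n : ℕ} (SA : StructPattern (Fin n) (Fin n)) : Store where
  v _ := 0
  a _ _ _ := 0
  low := (RAM.inputState SA).mem

theorem mul_add_inj_of_lt {n i j i' j' : ℕ} (hj : j < n) (hj' : j' < n)
    (h : i * n + j = i' * n + j') : i = i' ∧ j = j' := by
  have hi : i = i' := by
    have h1 : (i * n + j) / n = i := by
      rw [mul_comm, Nat.mul_add_div (by omega), Nat.div_eq_of_lt hj, add_zero]
    have h2 : (i' * n + j') / n = i' := by
      rw [mul_comm, Nat.mul_add_div (by omega), Nat.div_eq_of_lt hj', add_zero]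
    rw [← h1, h, h2]
  subst hi
  exact ⟨rfl, by omega⟩

theorem low_initialStore {n : ℕ} (SA : StructPattern (Fin n) (Fin n)) {i j : ℕ}
    (hi : i < n) (hj : j < n) :
    0 < (initialStore SA).low (i * n + j) ↔ patternRel SA i j := by
  simp only [initialStore, RAM.inputState]
  constructor
  · intro h
    by_contra hne
    rw [if_neg] at h
    · exact lt_irrefl _ h
    · rintro ⟨i', j', he, hij⟩
      obtain ⟨rfl, rfl⟩ := mul_add_inj_of_lt hj j'.2 he
      exact hne ⟨hi, hj, hij⟩
  · rintro ⟨hi, hj, hij⟩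
    rw [if_pos ⟨⟨i, hi⟩, ⟨j, hj⟩, rfl, hij⟩]
    exact one_pos

theorem represents_initialStore {n : ℕ} (SA : StructPattern (Fin n) (Fin n)) :
    Represents n (initialStore SA) (RAM.inputState SA) where
  size := by simp [RAM.inputState]
  var x := by simp [RAM.inputState, initialStore, Cmd.varReg]
  mat t i j := by
    simp only [RAM.inputState, initialStore]
    rw [if_neg]
    rintro ⟨i', j', h, -⟩
    have h1 := i'.2
    have h2 := j'.2
    have : i'.val * n + j'.val < n * n := by nlinarith
    unfold cellAddress at h
    omega
  low _ _ := rfl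

theorem bounded_initialStore {n : ℕ} (SA : StructPattern (Fin n) (Fin n)) :
    (initialStore SA).Bounded (n + 1) where
  var _ := Nat.zero_le _
  mat _ _ _ := Nat.zero_le _
  low x := by
    simp only [initialStore, RAM.inputState]
    split_ifs <;> omega

theorem mainTheorem4 :
    ∃ (P : RAM.Prog) (time : ℕ → ℕ) (c d : ℕ),
      (fun n : ℕ => (time n : ℝ)) =O[atTop] (fun n : ℕ => (n : ℝ) ^ 3) ∧
      ∀ (n : ℕ) (SA : StructPattern (Fin n) (Fin n)),
        ∃ (t : ℕ) (s : RAM.State) (J : Finset (Fin n)),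
          RAM.Exec (c * (n + 1) ^ d) P (RAM.inputState SA) t s ∧
          t ≤ time n ∧
          s.Outputs J ∧
          IsMinimumInputSelection SA (identityPattern n) J := by
  -- the last instruction moves the count into register `0`
  refine ⟨.seq (Cmd.main.compile 0) (.sub 0 (Cmd.varReg 13) (Cmd.varReg 0)),
    fun n => 2000 * (n + 1) ^ 3 + 1, 38 * 2001 ^ 4, 12, ?_, fun n SA => ?_⟩
  · refine IsBigO.of_bound 16001 (eventually_atTop.2 ⟨1, fun n hn => ?_⟩)
    have hn' : (1 : ℝ) ≤ n := by exact_mod_cast hn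
    have h1 : (1 : ℝ) ≤ (n : ℝ) ^ 3 := one_le_pow₀ hn'
    have h2 : ((n : ℝ) + 1) ^ 3 ≤ (2 * n) ^ 3 := by gcongr; linarith
    have h3 : (2 * (n : ℝ)) ^ 3 = 8 * (n : ℝ) ^ 3 := by ring
    rw [Real.norm_of_nonneg (by positivity), Real.norm_of_nonneg (by positivity)]
    push_cast
    linarith
  · obtain ⟨J, hJ, hlow, hcard, hzero⟩ := Cmd.eval_main (SA := SA) (s := initialStore SA)
      (fun i j hi hj => low_initialStore SA hi hj) (fun _ => rfl) (fun _ _ _ => rfl)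
    have hW : wordBound (n + 1 + Cmd.main.cost n) ≤ 38 * 2001 ^ 4 * (n + 1) ^ 12 := by
      have h1 := Cmd.cost_main_le n
      have h2 : n + 1 ≤ (n + 1) ^ 3 := Nat.le_self_pow (by norm_num) _
      refine (wordBound_mono (b' := 2001 * (n + 1) ^ 3) (by omega)).trans ?_
      refine (wordBound_le _).trans (le_of_eq (by ring))
    obtain ⟨t, σ, hex, ht, hσ, -⟩ := Cmd.exec_compile Cmd.main (d := 0)
      (represents_initialStore SA) (bounded_initialStore SA) (Nat.le_succ n) hW
    refine ⟨t + 1, _, J, .seq hex (.sub _ _ _ _), ?_, ⟨fun j => ?_, ?_⟩, hJ⟩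
    · exact Nat.succ_le_succ (ht.trans (Cmd.cost_main_le n))
    · have hj : (j : ℕ) < n * n := j.2.trans_le (Nat.le_mul_self n)
      simp only [RAM.State.setReg]
      rw [hσ.low j hj, hlow j]
    · simp [RAM.State.setReg, hσ.var, hcard, hzero]
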